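/- **Theorem (matricvariate $T$ distribution).** Let $\mathfrak F$ be one of the real normed division algebras $\mathbb R$, $\mathbb C$, $\mathbb H$ (real numbers, complex numbers, quaternions), of real dimension $\beta=1,2,4$ respectively, with conjugation $x\mapsto\bar x$, and write $A^*=\bar A^{T}$. For a Hermitian positive definite matrix $A$ over $\mathfrak F$ let $|A|$ be its determinant (the product of its eigenvalues; equivalently, the $\beta$-th root of the determinant of the real-linear map $x\mapsto Ax$ on $\mathfrak F^m$), and let $\mathfrak P_m^\beta$ be the cone of Hermitian positive definite $m\times m$ matrices over $\mathfrak F$. Let $(dX)=\prod_{i,j,k}dx_{ij}^{(k)}$ be Lebesgue measure on $\mathfrak F^{m\times n}$ in the $\beta mn$ real coordinates, let $(dA)=\prod_i da_{ii}\prod_{i<j}\prod_{k=1}^{\beta}da_{ij}^{(k)}$ be Lebesgue measure on the Hermitian $m\times m$ matrices, and put $$\Gamma_m^\beta[a]=\int_{\mathfrak P_m^\beta}e^{-\operatorname{tr}A}\,|A|^{a-(m-1)\beta/2-1}\,(dA),\qquad a>(m-1)\beta/2 .$$ Let $\Xi\in\mathfrak P_m^\beta$, $\Sigma\in\mathfrak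 P_n^\beta$, $\mu\in\mathfrak F^{m\times n}$, and let $\nu\in\mathbb R$ satisfy $\nu>\beta(m-1)$. Let $V\sim\mathcal W_m^\beta(\nu,\Xi)$, i.e. $V$ has on $\mathfrak P_m^\beta$ the density $$\frac{1}{(2\beta^{-1})^{\beta m\nu/2}\,\Gamma_m^\beta[\beta\nu/2]\,|\Xi|^{\beta\nu/2}}\;|V|^{\beta(\nu-m+1)/2-1}\exp\{-\tfrac{\beta}{2}\operatorname{Re}\operatorname{tr}\,\Xi^{-1}V\}$$ with respect to $(dV)$, and let $Y\sim\mathcal N_{m\times n}^\beta(0,I_m\otimes\Sigma)$, i.e. $Y$ has on $\mathfrak F^{m\times n}$ the density $$\frac{1}{(2\pi\beta^{-1})^{\beta mn/2}\,|\Sigma|^{\beta m/2}}\exp\{-\tfrac{\beta}{2}\operatorname{Re}\operatorname{tr}\,Y\Sigma^{-1}Y^*\}$$ with respect to $(dY)$. Let $L$ be any random $m\times m$ matrix over $\mathfrak F$ that is a square root of $V$ in the sense that $L^*L=V$ almost surely (for instance, any Hermitian square root, for which $L=L^*$ and $LL^*=L^2=V$), and assume that $L$ is independent of $Y$ (which is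 the case when $V$ is independent of $Y$ and $L$ is a measurable function of $V$). Then $$T=L^{-1}Y+\mu$$ has, with respect to Lebesgue measure $(dT)$ on $\mathfrak F^{m\times n}$, the density $$\frac{\Gamma_m^\beta[\beta(n+\nu)/2]}{\pi^{mn\beta/2}\,\Gamma_m^\beta[\beta\nu/2]\,|\Xi|^{\beta\nu/2}\,|\Sigma|^{\beta m/2}}\;\bigl|\Xi^{-1}+(T-\mu)\Sigma^{-1}(T-\mu)^*\bigr|^{-\beta(n+\nu)/2}.$$ -/

import Mathlib

open MeasureTheory ProbabilityTheory
open scoped Matrix Quaternion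

noncomputable section

namespace MatricT

/-- A (necessarily finite-dimensional, associative) real normed division algebra `F`:
`NormedDivisionRing` supplies `‖a * b‖ = ‖a‖ * ‖b‖`, `star` is the conjugation, and
`basis` is an orthonormal real basis, so that `basis.repr x k` is the `k`-th real
coordinate `x⁽ᵏ⁾` of `x`. The number `β` is the real dimension of `F`.
The instances below are `ℝ`, `ℂ` and `ℍ`, with `β = 1, 2, 4` and their standard bases. -/
class RealNormedDivisionAlgebra (F : Type*) [NormedDivisionRing F] [NormedAlgebra ℝ F]
    [StarRing F] where
  β : ℕ
  basis : Module.Basis (Fin β) ℝ F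
  norm_sq_eq : ∀ x : F, ‖x‖ ^ 2 = ∑ k, (basis.repr x k) ^ 2
  star_mul_self_eq : ∀ x : F, star x * x = algebraMap ℝ F (‖x‖ ^ 2)

instance instReal : RealNormedDivisionAlgebra ℝ where
  β := 1
  basis := Module.Basis.singleton (Fin 1) ℝ
  norm_sq_eq x := by simp
  star_mul_self_eq x := by simp [sq]

instance instComplex : RealNormedDivisionAlgebra ℂ where
  β := 2
  basis := Complex.basisOneI
  norm_sq_eq x := by
    rw [Complex.sq_norm, Complex.normSq_apply]
    simp [Complex.coe_basisOneI_repr, sq]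
  star_mul_self_eq x := by
    have := Complex.normSq_eq_conj_mul_self (z := x)
    simp only [Complex.sq_norm, Complex.coe_algebraMap, this]
    rfl

instance instQuaternion : RealNormedDivisionAlgebra ℍ where
  β := 4
  basis := QuaternionAlgebra.basisOneIJK (-1 : ℝ) 0 (-1)
  norm_sq_eq x := by
    rw [sq, ← Quaternion.normSq_eq_norm_mul_self, Quaternion.normSq_def']
    simp [Fin.sum_univ_four]
    rfl
  star_mul_self_eq x := by
    rw [Quaternion.star_mul_self, sq, ← Quaternion.normSq_eq_norm_mul_self]
    rfl

/-- Matrices over a measurable space carry the product `σ`-algebra of their entries. -/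
instance instMeasurableSpaceMatrix {ι κ F : Type*} [MeasurableSpace F] :
    MeasurableSpace (Matrix ι κ F) :=
  inferInstanceAs (MeasurableSpace (ι → κ → F))

section

variable (F : Type*) [NormedDivisionRing F] [NormedAlgebra ℝ F] [StarRing F]
  [RealNormedDivisionAlgebra F]

/-- The real dimension of the algebra, as a natural number. -/
abbrev dim : ℕ := RealNormedDivisionAlgebra.β F

/-- The real dimension `β` of the algebra, as a real number. -/
abbrev beta : ℝ := (RealNormedDivisionAlgebra.β F : ℝ)

variable {F}

/-- The element of `F` with given real coordinates. -/
def ofCoord (c : Fin (dim F) → ℝ) : F :=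
  ∑ k, c k • (RealNormedDivisionAlgebra.basis (F := F) k)

/-- The real part of `x`, i.e. the Euclidean inner product of `1` and `x`. -/
def re (x : F) : ℝ :=
  ∑ k, (RealNormedDivisionAlgebra.basis (F := F)).repr 1 k *
    (RealNormedDivisionAlgebra.basis (F := F)).repr x k

/-- `x + x̄ = 2 Re x`, so that `re` is the usual real part. -/
theorem add_star_eq (x : F) : x + star x = algebraMap ℝ F (2 * re x) := by
  have h1 := RealNormedDivisionAlgebra.star_mul_self_eq (1 + x)
  have h2 : ‖1 + x‖ ^ 2 = ‖(1 : F)‖ ^ 2 + 2 * re x + ‖x‖ ^ 2 := by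
    simp only [RealNormedDivisionAlgebra.norm_sq_eq, re, map_add, Finsupp.add_apply,
      Finset.mul_sum, ← Finset.sum_add_distrib]
    exact Finset.sum_congr rfl fun k _ => by ring
  rw [h2, map_add, map_add, ← RealNormedDivisionAlgebra.star_mul_self_eq x] at h1
  simp only [star_add, star_one, add_mul, mul_add, one_mul, mul_one, norm_one, one_pow,
    map_one] at h1
  have h3 : (1 + star x + (x + star x * x)) = 1 + (x + star x) + star x * x := by abel
  rw [h3] at h1
  exact add_left_cancel (add_right_cancel h1)

/-- `A` is a Hermitian positive definite matrix over `F` (for Hermitian `A` the scalar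
`x* A x` is real, so it equals its real part). -/
def PosDef {m : ℕ} (A : Matrix (Fin m) (Fin m) F) : Prop :=
  Aᴴ = A ∧ ∀ x : Fin m → F, x ≠ 0 → 0 < re (star x ⬝ᵥ (A *ᵥ x))

/-- The real-linear endomorphism `x ↦ A x` of `F ^ m`. -/
def mulVecReal {m : ℕ} (A : Matrix (Fin m) (Fin m) F) : (Fin m → F) →ₗ[ℝ] (Fin m → F) where
  toFun x := A *ᵥ x
  map_add' x y := Matrix.mulVec_add A x y
  map_smul' r x := Matrix.mulVec_smul A r x

/-- The (normalised, non-negative) determinant `|A|` of a square matrix over `F`: the `β`-th root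
of the absolute value of the determinant of the real-linear map `x ↦ A x` of `F ^ m`.
It is the absolute value of the usual determinant over `ℝ` and `ℂ` and the Dieudonné determinant
(with values in the non-negative reals) over `ℍ`; it is multiplicative, and on a Hermitian positive
definite matrix it is the determinant, that is, the product of the eigenvalues. -/
def det {m : ℕ} (A : Matrix (Fin m) (Fin m) F) : ℝ :=
  |LinearMap.det (mulVecReal A)| ^ (1 / beta F)

theorem det_mul {m : ℕ} (A B : Matrix (Fin m) (Fin m) F) : det (A * B) = det A * det B := by
  have : mulVecReal (A * B) = mulVecReal A ∘ₗ mulVecReal B := by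
    refine LinearMap.ext fun x => ?_
    simp [mulVecReal]
  rw [det, this, LinearMap.det_comp, abs_mul, Real.mul_rpow (abs_nonneg _) (abs_nonneg _)]
  rfl

theorem det_real {m : ℕ} (A : Matrix (Fin m) (Fin m) ℝ) : det A = |A.det| := by
  have h : mulVecReal A = Matrix.toLin' A := rfl
  have hb : beta ℝ = 1 := Nat.cast_one
  rw [det, h, LinearMap.det_toLin', hb]
  simp

theorem det_complex {m : ℕ} (A : Matrix (Fin m) (Fin m) ℂ) : det A = ‖A.det‖ := by
  have h : mulVecReal A = (Matrix.toLin' A).restrictScalars ℝ := rfl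
  have hb : beta ℂ = 2 := Nat.cast_two
  rw [det, h, LinearMap.det_restrictScalars, LinearMap.det_toLin', hb, Algebra.norm_complex_apply,
    Complex.normSq_eq_norm_sq, abs_of_nonneg (sq_nonneg _), ← Real.sqrt_eq_rpow,
    Real.sqrt_sq (norm_nonneg _)]

/-- On a real diagonal matrix with non-negative entries, `|A|` is the product of the entries. -/
theorem det_diagonal {m : ℕ} (d : Fin m → ℝ) (hd : ∀ i, 0 ≤ d i) :
    det (Matrix.diagonal fun i => algebraMap ℝ F (d i)) = ∏ i, d i := by
  have h : mulVecReal (Matrix.diagonal fun i => algebraMap ℝ F (d i)) =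
      LinearMap.pi fun i => (d i • (LinearMap.id : F →ₗ[ℝ] F)) ∘ₗ LinearMap.proj i := by
    refine LinearMap.ext fun x => funext fun i => ?_
    simp [mulVecReal, Matrix.mulVec_diagonal, Algebra.smul_def]
  have hfin : Module.finrank ℝ F = dim F := by
    simp [Module.finrank_eq_card_basis (RealNormedDivisionAlgebra.basis (F := F))]
  have : Module.Finite ℝ F := .of_basis (RealNormedDivisionAlgebra.basis (F := F))
  have hpos : 0 < dim F := hfin ▸ Module.finrank_pos
  have hdet : LinearMap.det (mulVecReal (Matrix.diagonal fun i => algebraMap ℝ F (d i))) =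
      (∏ i, d i) ^ dim F := by
    rw [h, LinearMap.det_pi]
    simp [LinearMap.det_smul, hfin, Finset.prod_pow]
  have hprod : 0 ≤ ∏ i, d i := Finset.prod_nonneg fun i _ => hd i
  rw [det, hdet, abs_of_nonneg (pow_nonneg hprod _), one_div,
    Real.pow_rpow_inv_natCast hprod hpos.ne']

/-- The Lebesgue measure `(dX)` on `F ^ (m × n)`, in the `β m n` real coordinates of `X`. -/
def lebesgue (F : Type*) [NormedDivisionRing F] [NormedAlgebra ℝ F] [StarRing F]
    [RealNormedDivisionAlgebra F] [MeasurableSpace F] (m n : ℕ) :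
    Measure (Matrix (Fin m) (Fin n) F) :=
  (volume : Measure (Fin m → Fin n → Fin (dim F) → ℝ)).map
    fun c => Matrix.of fun i j => ofCoord (c i j)

/-- The Hermitian matrix with real diagonal entries `c.1 i` and with strictly upper triangular
entries `sᵢⱼ` having the real coordinates `c.2 (i, j)`. -/
def hermitianOfCoord {m : ℕ}
    (c : (Fin m → ℝ) × ({p : Fin m × Fin m // p.1 < p.2} → Fin (dim F) → ℝ)) :
    Matrix (Fin m) (Fin m) F :=
  Matrix.of fun i j =>
    if h : i < j then ofCoord (c.2 ⟨(i, j), h⟩)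
    else if h : j < i then star (ofCoord (c.2 ⟨(j, i), h⟩))
    else algebraMap ℝ F (c.1 i)

/-- The Lebesgue measure `(dS)` on the space of Hermitian `m × m` matrices over `F`, in the real
coordinates `sᵢᵢ` and `sᵢⱼ⁽ᵏ⁾`, `i < j` (as a measure on all `m × m` matrices, carried by the
Hermitian ones). -/
def lebesgueHermitian (F : Type*) [NormedDivisionRing F] [NormedAlgebra ℝ F] [StarRing F]
    [RealNormedDivisionAlgebra F] [MeasurableSpace F] (m : ℕ) :
    Measure (Matrix (Fin m) (Fin m) F) :=
  (volume : Measure ((Fin m → ℝ) ×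
    ({p : Fin m × Fin m // p.1 < p.2} → Fin (dim F) → ℝ))).map hermitianOfCoord

/-- The Lebesgue measure restricted to the cone of positive definite matrices. -/
def lebesgueCone (F : Type*) [NormedDivisionRing F] [NormedAlgebra ℝ F] [StarRing F]
    [RealNormedDivisionAlgebra F] [MeasurableSpace F] (m : ℕ) :
    Measure (Matrix (Fin m) (Fin m) F) :=
  (lebesgueHermitian F m).restrict {A | PosDef A}

/-- The multivariate Gamma function
`Γ_m^β[a] = ∫_{A > 0} etr(-A) |A| ^ (a - (m - 1) β / 2 - 1) (dA)`. -/
def multiGamma (F : Type*) [NormedDivisionRing F] [NormedAlgebra ℝ F] [StarRing F]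
    [RealNormedDivisionAlgebra F] [MeasurableSpace F] (m : ℕ) (a : ℝ) : ℝ :=
  ∫ A, Real.exp (-re (Matrix.trace A)) * det A ^ (a - ((m : ℝ) - 1) * beta F / 2 - 1)
    ∂(lebesgueCone F m)

/-- The random element `X` has the density `f` with respect to `μ`. -/
def HasDensity {Ω E : Type*} [MeasurableSpace Ω] [MeasurableSpace E] (X : Ω → E) (P : Measure Ω)
    (μ : Measure E) (f : E → ℝ) : Prop :=
  AEMeasurable X P ∧ P.map X = μ.withDensity fun x => ENNReal.ofReal (f x)

/-- The density of the Wishart distribution `W_m^β(ν, Ξ)` on the cone of positive definite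
matrices. -/
def wishartDensity [MeasurableSpace F] {m : ℕ} (ν : ℝ) (Ξ V : Matrix (Fin m) (Fin m) F) : ℝ :=
  1 / ((2 / beta F) ^ (beta F * m * ν / 2) * multiGamma F m (beta F * ν / 2) *
      det Ξ ^ (beta F * ν / 2)) *
    det V ^ (beta F * (ν - m + 1) / 2 - 1) *
    Real.exp (-(beta F / 2) * re (Matrix.trace (Ring.inverse Ξ * V)))

/-- `V ∼ W_m^β(ν, Ξ)`. -/
def IsWishart {Ω : Type*} [MeasurableSpace Ω] [MeasurableSpace F] {m : ℕ}
    (V : Ω → Matrix (Fin m) (Fin m) F) (P : Measure Ω) (ν : ℝ)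
    (Ξ : Matrix (Fin m) (Fin m) F) : Prop :=
  HasDensity V P (lebesgueCone F m) (wishartDensity ν Ξ)

/-- The density of the matrix normal distribution `N_{m×n}^β(M, Θ ⊗ S)`. -/
def normalDensity {m n : ℕ} (M : Matrix (Fin m) (Fin n) F) (Θ : Matrix (Fin m) (Fin m) F)
    (S : Matrix (Fin n) (Fin n) F) (Y : Matrix (Fin m) (Fin n) F) : ℝ :=
  1 / ((2 * Real.pi / beta F) ^ (beta F * m * n / 2) *
      det Θ ^ (beta F * n / 2) * det S ^ (beta F * m / 2)) *
    Real.exp (-(beta F / 2) *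
      re (Matrix.trace (Ring.inverse Θ * (Y - M) * Ring.inverse S * (Y - M)ᴴ)))

/-- `Y ∼ N_{m×n}^β(M, Θ ⊗ S)`. -/
def IsMatrixNormal {Ω : Type*} [MeasurableSpace Ω] [MeasurableSpace F] {m n : ℕ}
    (Y : Ω → Matrix (Fin m) (Fin n) F) (P : Measure Ω) (M : Matrix (Fin m) (Fin n) F)
    (Θ : Matrix (Fin m) (Fin m) F) (S : Matrix (Fin n) (Fin n) F) : Prop :=
  HasDensity Y P (lebesgue F m n) (normalDensity M Θ S)

end

end MatricT

end

/-!
Since `L* L = V`, the matrix `L⁻¹ Y + μ` is, conditionally on `L`, matrix normal with mean `μ` and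
row covariance `V⁻¹`; its law depends on `L` only through `V`, so it is a mixture over the Wishart
law of `V`. The product of the Wishart density and the conditional normal density is, as a function
of `V`, a matrix Gamma density up to a constant, with rate `(β / 2) (Ξ⁻¹ + (T - μ) Σ⁻¹ (T - μ)*)`.
Writing the rate as `B* B` and substituting `V ↦ B V B*` integrates `V` out and leaves the stated
power of the determinant of the rate.

The Jacobian of the congruence `V ↦ B V B*` on Hermitian matrices is `|B| ^ (2 + (m - 1) β)`. It is
multiplicative in `B` and the same for `B` and `B*`, so it is determined by its value at `B* B`,
which is unitarily similar to a real diagonal matrix. The spectral theorem behind this comes from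
maximising the real quadratic form `Re (x* A x)`, which treats the three algebras uniformly.
-/

noncomputable section

namespace MatricT

section Algebra

theorem det_eq_det_of_isAdjointPair {K E : Type*} [Field K] [AddCommGroup E] [Module K E]
    [FiniteDimensional K E] {B : LinearMap.BilinForm K E} (hB : B.SeparatingLeft)
    {f g : E →ₗ[K] E} (h : LinearMap.IsAdjointPair B B f g) :
    LinearMap.det f = LinearMap.det g := by
  have hinj : Function.Injective B :=
    LinearMap.ker_eq_bot.1 (LinearMap.separatingLeft_iff_ker_eq_bot.1 hB)
  let e : E ≃ₗ[K] Module.Dual K E :=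
    LinearMap.linearEquivOfInjective B hinj Subspace.dual_finrank_eq.symm
  have hfg : e.toLinearMap ∘ₗ f ∘ₗ e.symm.toLinearMap = g.dualMap := by
    ext φ y
    have hφ : B (e.symm φ) = φ := e.apply_symm_apply φ
    simpa [e, hφ] using h (e.symm φ) y
  rw [← LinearMap.det_conj f e, hfg, LinearMap.det_dualMap]

theorem prod_ordered_pairs_mul {ι M : Type*} [Fintype ι] [LinearOrder ι] [LocallyFiniteOrderTop ι]
    [LocallyFiniteOrderBot ι] [CommMonoid M] (d : ι → M) :
    ∏ p : {p : ι × ι // p.1 < p.2}, d p.1.1 * d p.1.2 = (∏ i, d i) ^ (Fintype.card ι - 1) := by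
  rw [← Finset.prod_subtype (Finset.univ.filter fun p : ι × ι => p.1 < p.2) (by simp)
      fun p => d p.1 * d p.2,
    Finset.prod_finset_product _ Finset.univ Finset.Ioi (by simp),
    Finset.prod_prod_Ioi_mul_eq_prod_prod_off_diag fun _ i => d i]
  simp [Finset.card_compl, Finset.prod_pow]

variable {E : Type*} [AddCommGroup E] [Module ℝ E]

theorem separatingLeft_of_pos {B : LinearMap.BilinForm ℝ E} (hB : ∀ x, x ≠ 0 → 0 < B x x) :
    B.SeparatingLeft := fun x hx =>
  by_contra fun hne => (hB x hne).ne' (hx x)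

theorem exists_eigenvector_of_isAdjointPair_self [FiniteDimensional ℝ E] [Nontrivial E]
    {B : LinearMap.BilinForm ℝ E} (hsymm : ∀ x y, B x y = B y x)
    (hpos : ∀ x, x ≠ 0 → 0 < B x x) {f : E →ₗ[ℝ] E} (hf : LinearMap.IsAdjointPair B B f f) :
    ∃ (r : ℝ) (x : E), x ≠ 0 ∧ f x = r • x := by
  let core : InnerProductSpace.Core ℝ E :=
    { inner := fun x y => B x y
      conj_inner_symm := fun x y => hsymm y x
      re_inner_nonneg := fun x => by
        rcases eq_or_ne x 0 with rfl | hx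
        · simp
        · exact (hpos x hx).le
      add_left := fun x y z => by simp
      smul_left := fun x y r => by simp
      definite := fun x hx => by_contra fun hne => (hpos x hne).ne' hx }
  let _ : NormedAddCommGroup E := core.toNormedAddCommGroup
  let _ : InnerProductSpace ℝ E := InnerProductSpace.ofCore core.toCore
  have hsym : f.IsSymmetric := hf
  obtain ⟨x, hx⟩ := hsym.hasEigenvalue_iSup_of_finiteDimensional.exists_hasEigenvector
  exact ⟨_, x, hx.2, hx.apply_eq_smul⟩

theorem star_dotProduct_conj_mulVec {R ι κ : Type*} [Fintype ι] [Fintype κ] [Ring R] [StarRing R]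
    (X : Matrix ι κ R) (C : Matrix κ κ R) (x : ι → R) :
    star x ⬝ᵥ ((X * C * Xᴴ) *ᵥ x) = star (Xᴴ *ᵥ x) ⬝ᵥ (C *ᵥ (Xᴴ *ᵥ x)) := by
  rw [Matrix.star_mulVec, Matrix.conjTranspose_conjTranspose, ← Matrix.dotProduct_mulVec,
    Matrix.mulVec_mulVec, Matrix.mulVec_mulVec]

end Algebra

section RingInverse

theorem measurable_ringInverse {R : Type*} [NormedRing R] [HasSummableGeomSeries R]
    [MeasurableSpace R] [BorelSpace R] : Measurable (Ring.inverse : R → R) := by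
  have hunits : MeasurableSet {x : R | IsUnit x} := Units.isOpen.measurableSet
  refine measurable_of_restrict_of_restrict_compl hunits ?_ ?_
  · refine (continuous_iff_continuousAt.2 fun x => ?_).measurable
    obtain ⟨u, hu⟩ := x.2
    have hcont : ContinuousAt Ring.inverse (x : R) := hu ▸ NormedRing.inverse_continuousAt u
    exact hcont.comp continuous_subtype_val.continuousAt
  · have hzero : Set.domRestrict {x : R | IsUnit x}ᶜ Ring.inverse = fun _ => 0 :=
      funext fun x => Ring.inverse_non_unit _ x.2
    exact hzero ▸ measurable_const

end RingInverse

section HaarMeasure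

instance instIsAddHaarMeasureVolumePi {ι E : Type*} [Fintype ι] [NormedAddCommGroup E]
    [MeasureSpace E] [BorelSpace E] [ProperSpace E] [(volume : Measure E).IsAddHaarMeasure] :
    (volume : Measure (ι → E)).IsAddHaarMeasure :=
  inferInstanceAs (Measure.pi fun _ : ι => (volume : Measure E)).IsAddHaarMeasure

theorem map_map_of_semiconj {C E : Type*} [NormedAddCommGroup C] [NormedSpace ℝ C]
    [FiniteDimensional ℝ C] [MeasurableSpace C] [BorelSpace C] [MeasurableSpace E]
    (μ : Measure C) [μ.IsAddHaarMeasure] {f : C →ₗ[ℝ] C} (hf : LinearMap.det f ≠ 0)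
    {e : C → E} (he : Measurable e) {g : E → E} (hg : Measurable g)
    (h : Function.Semiconj e f g) :
    (μ.map e).map g = ENNReal.ofReal |LinearMap.det f|⁻¹ • μ.map e := by
  rw [Measure.map_map hg he, ← h.comp_eq,
    ← Measure.map_map he f.continuous_of_finiteDimensional.measurable,
    Measure.map_linearMap_addHaar_eq_smul_addHaar μ hf, Measure.map_smul, abs_inv]

end HaarMeasure

section Densities

variable {α β γ δ Ω : Type*} [MeasurableSpace α] [MeasurableSpace β] [MeasurableSpace γ]
  [MeasurableSpace δ] [MeasurableSpace Ω]

theorem map_withDensity_of_map_eq_smul {μ : Measure α} {ν : Measure β} {φ : α → β}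
    {f : α → ENNReal} {g : β → ENNReal} {c : ENNReal} (hφ : Measurable φ) (hg : Measurable g)
    (hc : c ≠ ⊤) (hμ : ν = c • μ.map φ) (hfg : ∀ x, f x = c * g (φ x)) :
    (μ.withDensity f).map φ = ν.withDensity g := by
  ext s hs
  rw [Measure.map_apply hφ hs, withDensity_apply _ (hφ hs), withDensity_apply _ hs, hμ,
    Measure.restrict_smul, lintegral_smul_measure, smul_eq_mul, setLIntegral_map hs hg hφ,
    ← lintegral_const_mul' c _ hc]
  exact lintegral_congr fun x => hfg x

theorem map_eq_withDensity_of_conditional_density {P : Measure Ω} [IsFiniteMeasure P]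
    {X : Ω → α} {Y : Ω → β} {Z : Ω → γ} (hX : AEMeasurable X P) (hY : AEMeasurable Y P)
    (hZ : AEMeasurable Z P) (hXY : IndepFun X Y P) {φ : α × β → δ} (hφ : Measurable φ)
    {κ : Measure δ} [SFinite κ] {f : γ → δ → ENNReal} (hf : Measurable (Function.uncurry f))
    (hcond : ∀ᵐ ω ∂P, (P.map Y).map (fun y => φ (X ω, y)) = κ.withDensity (f (Z ω))) :
    P.map (fun ω => φ (X ω, Y ω)) = κ.withDensity fun t => ∫⁻ z, f z t ∂P.map Z := by
  ext s hs
  calc P.map (fun ω => φ (X ω, Y ω)) s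
      = ((P.map X).prod (P.map Y)) (φ ⁻¹' s) := by
        rw [← (indepFun_iff_map_prod_eq_prod_map_map hX hY).1 hXY,
          ← Measure.map_apply hφ hs, AEMeasurable.map_map_of_aemeasurable hφ.aemeasurable
            (hX.prodMk hY)]
        rfl
    _ = ∫⁻ ω, (P.map Y).map (fun y => φ (X ω, y)) s ∂P := by
        rw [Measure.prod_apply (hφ hs),
          lintegral_map' (measurable_measure_prodMk_left (hφ hs)).aemeasurable hX]
        refine lintegral_congr fun ω => ?_
        exact (Measure.map_apply (hφ.comp measurable_prodMk_left) hs).symm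
    _ = ∫⁻ ω, ∫⁻ t in s, f (Z ω) t ∂κ ∂P := by
        refine lintegral_congr_ae (hcond.mono fun ω hω => ?_)
        simp only [hω, withDensity_apply _ hs]
    _ = ∫⁻ z, ∫⁻ t in s, f z t ∂κ ∂P.map Z :=
        (lintegral_map' hf.lintegral_prod_right'.aemeasurable hZ).symm
    _ = ∫⁻ t in s, ∫⁻ z, f z t ∂P.map Z ∂κ := lintegral_lintegral_swap hf.aemeasurable
    _ = κ.withDensity (fun t => ∫⁻ z, f z t ∂P.map Z) s := (withDensity_apply _ hs).symm

theorem ne_top_of_isFiniteMeasure_withDensity_mul {κ : Measure α} [NeZero κ] {f : α → ENNReal}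
    (hf : ∀ x, f x ≠ 0) (c : ENNReal) [IsFiniteMeasure (κ.withDensity fun x => f x * c)] :
    c ≠ ⊤ := by
  rintro rfl
  have huniv := measure_ne_top (κ.withDensity fun x => f x * ⊤) Set.univ
  simp only [ENNReal.mul_top (hf _), withDensity_const, Measure.smul_apply, smul_eq_mul] at huniv
  exact huniv (ENNReal.top_mul (NeZero.ne _))

end Densities

section RealDiagonal

variable (F : Type*) [NormedDivisionRing F] [NormedAlgebra ℝ F] {m : ℕ}

/-- The diagonal matrix over `F` with real entries `d i`. -/
def realDiagonal (d : Fin m → ℝ) : Matrix (Fin m) (Fin m) F :=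
  Matrix.diagonal fun i => algebraMap ℝ F (d i)

variable {F}

theorem realDiagonal_mul (d e : Fin m → ℝ) :
    realDiagonal F d * realDiagonal F e = realDiagonal F fun i => d i * e i := by
  simp [realDiagonal]

theorem realDiagonal_const_mul (r : ℝ) (A : Matrix (Fin m) (Fin m) F) :
    realDiagonal F (fun _ => r) * A = r • A := by
  ext i j
  simp [realDiagonal, Algebra.smul_def]

end RealDiagonal

variable {F : Type*} [NormedDivisionRing F] [NormedAlgebra ℝ F] [StarRing F]
  [RealNormedDivisionAlgebra F] {m n : ℕ}

section Scalars

instance instFiniteDimensional : FiniteDimensional ℝ F :=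
  .of_basis (RealNormedDivisionAlgebra.basis (F := F))

theorem finrank_eq_dim : Module.finrank ℝ F = dim F := by
  simp [Module.finrank_eq_card_basis (RealNormedDivisionAlgebra.basis (F := F))]

theorem dim_pos : 0 < dim F :=
  finrank_eq_dim (F := F) ▸ Module.finrank_pos

theorem beta_pos : 0 < beta F :=
  Nat.cast_pos.2 dim_pos

variable (F) in
/-- The real part `re`, bundled as a real-linear functional. -/
def reLinear : F →ₗ[ℝ] ℝ where
  toFun := re
  map_add' x y := by simp [re, mul_add, Finset.sum_add_distrib]
  map_smul' r x := by simp [re, Finset.mul_sum, mul_left_comm]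

theorem re_zero : re (0 : F) = 0 := map_zero (reLinear F)

theorem re_add (x y : F) : re (x + y) = re x + re y := map_add (reLinear F) x y

theorem re_sub (x y : F) : re (x - y) = re x - re y := map_sub (reLinear F) x y

theorem re_smul (r : ℝ) (x : F) : re (r • x) = r * re x := map_smul (reLinear F) r x

theorem re_sum {ι : Type*} (s : Finset ι) (f : ι → F) : re (∑ i ∈ s, f i) = ∑ i ∈ s, re (f i) :=
  map_sum (reLinear F) f s

theorem continuous_re : Continuous (re : F → ℝ) :=
  (reLinear F).continuous_of_finiteDimensional

theorem re_one : re (1 : F) = 1 := by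
  have h := RealNormedDivisionAlgebra.norm_sq_eq (1 : F)
  simpa [re, sq] using h.symm

theorem re_algebraMap (r : ℝ) : re (algebraMap ℝ F r) = r := by
  rw [Algebra.algebraMap_eq_smul_one, re_smul, re_one, mul_one]

theorem star_eq_sub (x : F) : star x = algebraMap ℝ F (2 * re x) - x := by
  rw [← add_star_eq, add_sub_cancel_left]

theorem re_star (x : F) : re (star x) = re x := by
  rw [star_eq_sub, re_sub, re_algebraMap]
  ring

theorem star_algebraMap (r : ℝ) : star (algebraMap ℝ F r) = algebraMap ℝ F r := by
  rw [star_eq_sub, re_algebraMap, two_mul, map_add, add_sub_cancel_right]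

instance instStarModule : StarModule ℝ F where
  star_smul r x := by
    rw [Algebra.smul_def, star_mul, star_algebraMap, ← Algebra.commutes, ← Algebra.smul_def,
      star_trivial r]

theorem algebraMap_re_of_star_eq {x : F} (hx : star x = x) : algebraMap ℝ F (re x) = x := by
  have h : (2 : ℝ) • algebraMap ℝ F (re x) = (2 : ℝ) • x := by
    rw [Algebra.smul_def, ← map_mul, ← add_star_eq, hx, two_smul]
  exact smul_right_injective F (two_ne_zero (α := ℝ)) h

theorem re_star_mul_self (x : F) : re (star x * x) = ‖x‖ ^ 2 := by
  rw [RealNormedDivisionAlgebra.star_mul_self_eq, re_algebraMap]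

theorem norm_star_eq (x : F) : ‖star x‖ = ‖x‖ := by
  rcases eq_or_ne x 0 with rfl | hx
  · rw [star_zero]
  · have h := congrArg norm (RealNormedDivisionAlgebra.star_mul_self_eq x)
    rw [norm_mul, norm_algebraMap', norm_pow, norm_norm, sq] at h
    exact mul_right_cancel₀ (norm_ne_zero_iff.2 hx) h

instance instNormedStarGroup : NormedStarGroup F where
  norm_star_le x := (norm_star_eq x).le

theorem re_mul_comm (x y : F) : re (x * y) = re (y * x) := by
  rw [← re_star, star_mul, star_eq_sub, star_eq_sub]
  simp only [sub_mul, mul_sub, re_sub, ← map_mul, re_algebraMap, ← Algebra.commutes _ y,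
    ← Algebra.smul_def, re_smul]
  ring

theorem re_trace_mul_comm {ι κ : Type*} [Fintype ι] [Fintype κ] (A : Matrix ι κ F)
    (B : Matrix κ ι F) : re (A * B).trace = re (B * A).trace := by
  simp only [Matrix.trace, Matrix.diag, Matrix.mul_apply, re_sum]
  rw [Finset.sum_comm]
  exact Finset.sum_congr rfl fun j _ => Finset.sum_congr rfl fun i _ => re_mul_comm _ _

variable (F m) in
/-- The real inner product `Re (x* y)` on `F ^ m`; `A` and `Aᴴ` are adjoint for it. -/
def vecForm : LinearMap.BilinForm ℝ (Fin m → F) :=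
  LinearMap.mk₂ ℝ (fun x y => re (star x ⬝ᵥ y))
    (fun x x' y => by simp [re_add]) (fun r x y => by simp [star_smul, re_smul])
    (fun x y y' => by simp [re_add]) (fun r x y => by simp [re_smul])

theorem vecForm_apply (x y : Fin m → F) : vecForm F m x y = re (star x ⬝ᵥ y) := rfl

theorem vecForm_symm (x y : Fin m → F) : vecForm F m x y = vecForm F m y x := by
  rw [vecForm_apply, vecForm_apply, ← re_star, ← Matrix.star_dotProduct]

theorem vecForm_self (x : Fin m → F) : vecForm F m x x = ∑ i, ‖x i‖ ^ 2 := by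
  simp [vecForm_apply, dotProduct, re_sum, re_star_mul_self]

theorem vecForm_self_pos (x : Fin m → F) (hx : x ≠ 0) : 0 < vecForm F m x x := by
  obtain ⟨i, hi⟩ := Function.ne_iff.1 hx
  rw [vecForm_self]
  exact Finset.sum_pos' (fun j _ => sq_nonneg _)
    ⟨i, Finset.mem_univ i, pow_pos (norm_pos_iff.2 hi) 2⟩

theorem isAdjointPair_vecForm (A : Matrix (Fin m) (Fin m) F) :
    LinearMap.IsAdjointPair (vecForm F m) (vecForm F m) (mulVecReal A) (mulVecReal Aᴴ) := by
  intro x y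
  change re (star (A *ᵥ x) ⬝ᵥ y) = re (star x ⬝ᵥ (Aᴴ *ᵥ y))
  rw [Matrix.star_mulVec, Matrix.dotProduct_mulVec]

end Scalars

section Determinant

theorem conjTranspose_realDiagonal (d : Fin m → ℝ) :
    (realDiagonal F d)ᴴ = realDiagonal F d := by
  rw [realDiagonal, Matrix.diagonal_conjTranspose]
  exact congrArg Matrix.diagonal (funext fun i => star_algebraMap (d i))

theorem det_nonneg (A : Matrix (Fin m) (Fin m) F) : 0 ≤ det A :=
  Real.rpow_nonneg (abs_nonneg _) _

theorem abs_det_mulVecReal (A : Matrix (Fin m) (Fin m) F) :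
    |LinearMap.det (mulVecReal A)| = det A ^ dim F := by
  rw [det, one_div, Real.rpow_inv_natCast_pow (abs_nonneg _) dim_pos.ne']

theorem det_realDiagonal (d : Fin m → ℝ) : det (realDiagonal F d) = |∏ i, d i| := by
  have hsq : det (realDiagonal F d) ^ 2 = (∏ i, d i) ^ 2 := by
    rw [sq, ← det_mul, realDiagonal_mul, realDiagonal, det_diagonal _ fun i => mul_self_nonneg _,
      Finset.prod_mul_distrib, sq]
  rw [← abs_of_nonneg (det_nonneg (realDiagonal F d)), (sq_eq_sq_iff_abs_eq_abs _ _).1 hsq]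

theorem det_smul (r : ℝ) (A : Matrix (Fin m) (Fin m) F) : det (r • A) = |r| ^ m * det A := by
  rw [← realDiagonal_const_mul, det_mul, det_realDiagonal]
  simp [abs_pow]

theorem det_one : det (1 : Matrix (Fin m) (Fin m) F) = 1 := by
  simpa [realDiagonal] using det_realDiagonal (F := F) (m := m) fun _ => 1

theorem det_pos_of_isUnit {A : Matrix (Fin m) (Fin m) F} (hA : IsUnit A) : 0 < det A := by
  obtain ⟨C, hAC⟩ := hA.exists_right_inv
  refine (det_nonneg A).lt_of_ne' fun h => zero_ne_one (α := ℝ) ?_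
  rw [← zero_mul (det C), ← h, ← det_mul, hAC, det_one]

theorem det_inverse {A : Matrix (Fin m) (Fin m) F} (hA : IsUnit A) :
    det (Ring.inverse A) = (det A)⁻¹ := by
  refine eq_inv_of_mul_eq_one_left ?_
  rw [← det_mul, Ring.inverse_mul_cancel A hA, det_one]

theorem det_conjTranspose (A : Matrix (Fin m) (Fin m) F) : det Aᴴ = det A := by
  rw [det, det, det_eq_det_of_isAdjointPair (separatingLeft_of_pos vecForm_self_pos)
    (isAdjointPair_vecForm A)]

theorem continuous_det : Continuous (det : Matrix (Fin m) (Fin m) F → ℝ) := by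
  let φ : Matrix (Fin m) (Fin m) F →ₗ[ℝ] ((Fin m → F) →L[ℝ] (Fin m → F)) :=
    { toFun := fun A => LinearMap.toContinuousLinearMap (mulVecReal A)
      map_add' := fun A B => by ext x i; simp [mulVecReal, Matrix.add_mulVec]
      map_smul' := fun r A => by ext x i; simp [mulVecReal, Matrix.smul_mulVec] }
  have hφ : Continuous φ := φ.continuous_of_finiteDimensional
  exact (ContinuousLinearMap.continuous_det.comp hφ).abs.rpow_const
    fun _ => Or.inr (one_div_nonneg.2 beta_pos.le)

theorem isUnit_of_mulVec_injective {A : Matrix (Fin m) (Fin m) F}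
    (hA : Function.Injective A.mulVec) : IsUnit A := by
  have hsurj : Function.Surjective (mulVecReal A) := LinearMap.injective_iff_surjective.1 hA
  choose x hx using fun j : Fin m => hsurj (Pi.single j 1)
  have hAx : A * Matrix.of (fun i j => x j i) = 1 := by
    ext i j
    rw [Matrix.one_apply, ← Pi.single_apply, ← hx j]
    rfl
  exact .of_mul_eq_one _ hAx

end Determinant

section PositiveDefinite

variable {A B : Matrix (Fin m) (Fin m) F}

theorem PosDef.isUnit (hA : PosDef A) : IsUnit A := by
  refine isUnit_of_mulVec_injective ((injective_iff_map_eq_zero (mulVecReal A)).2 fun x hx => ?_)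
  by_contra hne
  have hpos := hA.2 x hne
  rw [show A *ᵥ x = 0 from hx, dotProduct_zero, re_zero] at hpos
  exact lt_irrefl _ hpos

theorem PosDef.det_pos (hA : PosDef A) : 0 < det A :=
  det_pos_of_isUnit hA.isUnit

theorem PosDef.conj (hA : PosDef A) (hB : IsUnit B) : PosDef (B * A * Bᴴ) := by
  refine ⟨by simp [Matrix.conjTranspose_mul, hA.1, Matrix.mul_assoc], fun x hx => ?_⟩
  rw [star_dotProduct_conj_mulVec]
  refine hA.2 _ fun hBx => hx ?_
  obtain ⟨C, hC⟩ := hB.star.exists_left_inv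
  rw [← Matrix.one_mulVec x, ← hC, ← Matrix.mulVec_mulVec, Matrix.star_eq_conjTranspose, hBx,
    Matrix.mulVec_zero]

theorem posDef_conj_iff (hB : IsUnit B) : PosDef (B * A * Bᴴ) ↔ PosDef A := by
  refine ⟨fun h => ?_, fun hA => hA.conj hB⟩
  obtain ⟨C, hC⟩ := hB.exists_left_inv
  have hC' : Bᴴ * Cᴴ = 1 := by rw [← Matrix.conjTranspose_mul, hC, Matrix.conjTranspose_one]
  have hA : C * (B * A * Bᴴ) * Cᴴ = A := by
    rw [mul_assoc B, ← mul_assoc C, hC, one_mul, mul_assoc, hC', mul_one]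
  exact hA ▸ h.conj (.of_mul_eq_one _ hC)

theorem PosDef.inverse (hA : PosDef A) : PosDef (Ring.inverse A) := by
  have hstar : (Ring.inverse A)ᴴ = Ring.inverse A := by
    rw [← Matrix.star_eq_conjTranspose, ← Ring.inverse_star, Matrix.star_eq_conjTranspose, hA.1]
  have h := hA.conj hA.isUnit.ringInverse
  rwa [hstar, Ring.inverse_mul_cancel A hA.isUnit, one_mul] at h

theorem PosDef.smul (hA : PosDef A) {r : ℝ} (hr : 0 < r) : PosDef (r • A) := by
  refine ⟨by rw [Matrix.conjTranspose_smul, star_trivial, hA.1], fun x hx => ?_⟩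
  rw [Matrix.smul_mulVec, dotProduct_smul, re_smul]
  exact mul_pos hr (hA.2 x hx)

theorem PosDef.add_conj {C : Matrix (Fin n) (Fin n) F} (hA : PosDef A) (hC : PosDef C)
    (X : Matrix (Fin m) (Fin n) F) : PosDef (A + X * C * Xᴴ) := by
  refine ⟨by simp [Matrix.conjTranspose_mul, hA.1, hC.1, Matrix.mul_assoc], fun x hx => ?_⟩
  rw [Matrix.add_mulVec, dotProduct_add, re_add, star_dotProduct_conj_mulVec]
  refine add_pos_of_pos_of_nonneg (hA.2 x hx) ?_
  rcases eq_or_ne (Xᴴ *ᵥ x) 0 with h0 | h0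
  · rw [h0, Matrix.mulVec_zero, dotProduct_zero, re_zero]
  · exact (hC.2 _ h0).le

end PositiveDefinite

section Spectral

variable {A : Matrix (Fin m) (Fin m) F}

theorem exists_eigenvector_orthogonal (hA : Aᴴ = A) {k : ℕ} (hk : k < m)
    {w : Fin k → Fin m → F} {l : Fin k → ℝ} (hw : ∀ i, A *ᵥ w i = l i • w i) :
    ∃ (r : ℝ) (x : Fin m → F), x ≠ 0 ∧ A *ᵥ x = r • x ∧ ∀ i, star (w i) ⬝ᵥ x = 0 := by
  let f : (Fin m → F) →ₗ[ℝ] (Fin k → F) :=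
    { toFun := fun x i => star (w i) ⬝ᵥ x
      map_add' := fun x y => by ext i; simp
      map_smul' := fun r x => by ext i; simp }
  have mem_ker : ∀ x, x ∈ f.ker ↔ ∀ i, star (w i) ⬝ᵥ x = 0 := fun x => funext_iff
  have hker : f.ker ≠ ⊥ := by
    apply LinearMap.ker_ne_bot_of_finrank_lt
    simpa [Module.finrank_pi_fintype, finrank_eq_dim] using
      Nat.mul_lt_mul_of_pos_right hk (dim_pos (F := F))
  have : Nontrivial f.ker := Submodule.nontrivial_iff_ne_bot.2 hker
  have hinv : ∀ x ∈ f.ker, mulVecReal A x ∈ f.ker := by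
    intro x hx
    rw [mem_ker] at hx ⊢
    intro i
    change star (w i) ⬝ᵥ (A *ᵥ x) = 0
    rw [Matrix.dotProduct_mulVec, ← hA, ← Matrix.star_mulVec, hw, star_smul, smul_dotProduct,
      hx i, smul_zero]
  obtain ⟨r, ⟨x, hx⟩, hx0, hAx⟩ := exists_eigenvector_of_isAdjointPair_self
    (B := (vecForm F m).compl₁₂ f.ker.subtype f.ker.subtype)
    (fun x y => vecForm_symm x.1 y.1) (fun x hx => vecForm_self_pos _ (by simpa using hx))
    (f := (mulVecReal A).restrict hinv)
    (fun x y => (isAdjointPair_vecForm A x.1 y.1).trans (by rw [hA]; rfl))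
  exact ⟨r, x, fun h => hx0 (Subtype.ext h), congrArg Subtype.val hAx, (mem_ker x).1 hx⟩

theorem exists_unit_smul {x : Fin m → F} (hx : x ≠ 0) :
    ∃ c : ℝ, star (c • x) ⬝ᵥ (c • x) = 1 := by
  have hq := vecForm_self_pos x hx
  have hxx : star x ⬝ᵥ x = algebraMap ℝ F (vecForm F m x x) := by
    simp [vecForm_self, dotProduct, RealNormedDivisionAlgebra.star_mul_self_eq]
  refine ⟨(√(vecForm F m x x))⁻¹, ?_⟩
  rw [star_smul, star_trivial, smul_dotProduct, dotProduct_smul, hxx, smul_smul,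
    ← mul_inv, Real.mul_self_sqrt hq.le, Algebra.smul_def, ← map_mul, inv_mul_cancel₀ hq.ne',
    map_one]

theorem exists_orthonormal_eigenvectors (hA : Aᴴ = A) {k : ℕ} (hk : k ≤ m) :
    ∃ (w : Fin k → Fin m → F) (l : Fin k → ℝ),
      (∀ i j, star (w i) ⬝ᵥ w j = if i = j then 1 else 0) ∧ ∀ i, A *ᵥ w i = l i • w i := by
  induction k with
  | zero => exact ⟨Fin.elim0, Fin.elim0, fun i => i.elim0, fun i => i.elim0⟩
  | succ k ih =>
    obtain ⟨w, l, hw, hl⟩ := ih (Nat.le_of_succ_le hk)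
    obtain ⟨r, x, hx, hAx, hwx⟩ := exists_eigenvector_orthogonal hA hk hl
    obtain ⟨c, hc⟩ := exists_unit_smul hx
    have hwc : ∀ i, star (w i) ⬝ᵥ (c • x) = 0 := fun i => by
      rw [dotProduct_smul, hwx i, smul_zero]
    have hcw : ∀ i, star (c • x) ⬝ᵥ w i = 0 := fun i => by
      rw [Matrix.star_dotProduct, hwc i, star_zero]
    refine ⟨Fin.snoc w (c • x), Fin.snoc l r, fun i j => ?_, fun i => ?_⟩
    · refine Fin.lastCases ?_ (fun i => ?_) i <;> refine Fin.lastCases ?_ (fun j => ?_) j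
      · simpa only [Fin.snoc_last, if_pos] using hc
      · simpa [Fin.ext_iff, j.2.ne'] using hcw j
      · simpa [Fin.ext_iff, i.2.ne] using hwc i
      · simpa using hw i j
    · refine Fin.lastCases ?_ (fun i => ?_) i
      · simp only [Fin.snoc_last, Matrix.mulVec_smul, hAx, smul_comm c]
      · simpa using hl i

theorem exists_unitary_diagonalization (hA : Aᴴ = A) :
    ∃ (W : Matrix (Fin m) (Fin m) F) (d : Fin m → ℝ),
      W * Wᴴ = 1 ∧ A = Wᴴ * realDiagonal F d * W := by
  obtain ⟨w, l, hw, hl⟩ := exists_orthonormal_eigenvectors hA le_rfl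
  let W : Matrix (Fin m) (Fin m) F := Matrix.of fun i j => star (w i j)
  have hW : W * Wᴴ = 1 := by
    ext i j
    rw [Matrix.one_apply, ← hw i j]
    simp [W, Matrix.mul_apply, dotProduct]
  have hAW : A * Wᴴ = Wᴴ * realDiagonal F l := by
    ext i j
    have hij := congrFun (hl j) i
    rw [Pi.smul_apply, Algebra.smul_def, Algebra.commutes] at hij
    rw [realDiagonal, Matrix.mul_diagonal]
    simpa [W, Matrix.mul_apply, Matrix.mulVec, dotProduct] using hij
  refine ⟨W, l, hW, ?_⟩
  rw [← hAW, Matrix.mul_assoc, mul_eq_one_symm hW, Matrix.mul_one]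

theorem det_eq_one_of_unitary {W : Matrix (Fin m) (Fin m) F} (hW : W * Wᴴ = 1) : det W = 1 := by
  have h := det_mul W Wᴴ
  rw [hW, det_one, det_conjTranspose] at h
  nlinarith [det_nonneg W]

theorem PosDef.realDiagonal_pos {d : Fin m → ℝ} (hd : PosDef (realDiagonal F d)) (i : Fin m) :
    0 < d i := by
  have h := hd.2 (Pi.single i 1) (by simp)
  simpa [realDiagonal, ← Pi.single_star, re_algebraMap] using h

theorem PosDef.exists_conjTranspose_mul_self (hA : PosDef A) :
    ∃ B : Matrix (Fin m) (Fin m) F, Bᴴ * B = A := by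
  obtain ⟨W, d, hW, hAd⟩ := exists_unitary_diagonalization hA.1
  have hd : ∀ i, 0 < d i := by
    refine PosDef.realDiagonal_pos (F := F) ?_
    rw [← posDef_conj_iff (IsUnit.of_mul_eq_one _ (mul_eq_one_symm hW)),
      Matrix.conjTranspose_conjTranspose, ← hAd]
    exact hA
  refine ⟨realDiagonal F (fun i => √(d i)) * W, ?_⟩
  have hsqrt : (fun i => √(d i) * √(d i)) = d := funext fun i => Real.mul_self_sqrt (hd i).le
  rw [hAd, Matrix.conjTranspose_mul, conjTranspose_realDiagonal, Matrix.mul_assoc,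
    ← Matrix.mul_assoc (realDiagonal F _), realDiagonal_mul, hsqrt, Matrix.mul_assoc]

end Spectral

section Congruence

variable (F) in
/-- The identification of `F` with its real coordinates, whose underlying map is `ofCoord`. -/
def coordEquiv : (Fin (dim F) → ℝ) ≃ₗ[ℝ] F :=
  (RealNormedDivisionAlgebra.basis (F := F)).equivFun.symm

theorem coordEquiv_apply (c : Fin (dim F) → ℝ) : coordEquiv F c = ofCoord c := by
  simp [coordEquiv, ofCoord, Module.Basis.equivFun_symm_apply]

variable (F m) in
/-- The space of real coordinates of Hermitian `m × m` matrices, the domain of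
`hermitianOfCoord`. -/
abbrev HermitianCoord : Type :=
  (Fin m → ℝ) × ({p : Fin m × Fin m // p.1 < p.2} → Fin (dim F) → ℝ)

variable (F m) in
/-- The map `hermitianOfCoord`, bundled as a real-linear map. -/
def hermitianLinear : HermitianCoord F m →ₗ[ℝ] Matrix (Fin m) (Fin m) F where
  toFun := hermitianOfCoord
  map_add' c c' := by
    ext i j
    simp only [hermitianOfCoord, Matrix.of_apply, Matrix.add_apply, ← coordEquiv_apply]
    split_ifs <;> simp
  map_smul' r c := by
    ext i j
    simp only [hermitianOfCoord, Matrix.of_apply, Matrix.smul_apply, ← coordEquiv_apply]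
    split_ifs
    · simp
    · simp [star_smul]
    · simp [Algebra.smul_def]

variable (F m) in
/-- The coordinates of a Hermitian matrix, extended to all matrices by reading off the upper
triangular part. -/
def hermitianRepr : Matrix (Fin m) (Fin m) F →ₗ[ℝ] HermitianCoord F m where
  toFun A := (fun i => re (A i i), fun p => (coordEquiv F).symm (A p.1.1 p.1.2))
  map_add' A B := by ext <;> simp [re_add]
  map_smul' r A := by ext <;> simp [re_smul]

theorem hermitianRepr_hermitianOfCoord (c : HermitianCoord F m) :
    hermitianRepr F m (hermitianOfCoord c) = c := by
  refine Prod.ext (funext fun i => ?_) (funext fun p => ?_)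
  · simp [hermitianRepr, hermitianOfCoord, re_algebraMap]
  · simp [hermitianRepr, hermitianOfCoord, p.2, ← coordEquiv_apply]

theorem hermitianOfCoord_injective :
    Function.Injective (hermitianOfCoord : HermitianCoord F m → Matrix (Fin m) (Fin m) F) :=
  Function.LeftInverse.injective hermitianRepr_hermitianOfCoord

theorem hermitianOfCoord_hermitianRepr {A : Matrix (Fin m) (Fin m) F} (hA : Aᴴ = A) :
    hermitianOfCoord (hermitianRepr F m A) = A := by
  ext i j
  have hs : ∀ i j, star (A j i) = A i j := fun i j => congrFun (congrFun hA i) j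
  simp only [hermitianOfCoord, hermitianRepr, LinearMap.coe_mk, AddHom.coe_mk, Matrix.of_apply,
    ← coordEquiv_apply, LinearEquiv.apply_symm_apply]
  split_ifs with hij hji
  · rfl
  · exact hs i j
  · obtain rfl : i = j := le_antisymm (not_lt.1 hji) (not_lt.1 hij)
    exact algebraMap_re_of_star_eq (hs i i)

theorem conjTranspose_hermitianOfCoord (c : HermitianCoord F m) :
    (hermitianOfCoord c)ᴴ = hermitianOfCoord (F := F) c := by
  ext i j
  simp only [hermitianOfCoord, Matrix.conjTranspose_apply, Matrix.of_apply]
  rcases lt_trichotomy i j with h | rfl | h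
  · simp [h, h.not_gt]
  · simp [star_algebraMap]
  · simp [h, h.not_gt]

/-- The congruence `S ↦ B S Bᴴ` of Hermitian matrices, in coordinates. -/
def congruence (B : Matrix (Fin m) (Fin m) F) : HermitianCoord F m →ₗ[ℝ] HermitianCoord F m where
  toFun c := hermitianRepr F m (B * hermitianLinear F m c * Bᴴ)
  map_add' c c' := by simp [Matrix.mul_add, Matrix.add_mul]
  map_smul' r c := by simp

theorem hermitianOfCoord_congruence (B : Matrix (Fin m) (Fin m) F) (c : HermitianCoord F m) :
    hermitianOfCoord (congruence B c) = B * hermitianOfCoord c * Bᴴ :=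
  hermitianOfCoord_hermitianRepr (A := B * hermitianOfCoord c * Bᴴ) (by
    simp [Matrix.conjTranspose_mul, conjTranspose_hermitianOfCoord, Matrix.mul_assoc])

theorem congruence_mul (B C : Matrix (Fin m) (Fin m) F) :
    congruence (B * C) = congruence B ∘ₗ congruence C := by
  refine LinearMap.ext fun c => hermitianOfCoord_injective ?_
  simp only [LinearMap.comp_apply, hermitianOfCoord_congruence, Matrix.conjTranspose_mul,
    Matrix.mul_assoc]

theorem congruence_one : congruence (1 : Matrix (Fin m) (Fin m) F) = LinearMap.id := by
  refine LinearMap.ext fun c => hermitianOfCoord_injective ?_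
  simp [hermitianOfCoord_congruence]

variable (F m) in
/-- The inner product `Re tr (S T)` of Hermitian matrices, in coordinates; the congruences by `B`
and `Bᴴ` are adjoint for it. -/
def hermitianForm : LinearMap.BilinForm ℝ (HermitianCoord F m) :=
  LinearMap.mk₂ ℝ (fun c c' => re (hermitianLinear F m c * hermitianLinear F m c').trace)
    (fun c c' e => by simp [Matrix.add_mul, re_add]) (fun r c e => by simp [re_smul])
    (fun c e e' => by simp [Matrix.mul_add, re_add]) (fun r c e => by simp [re_smul])

theorem hermitianForm_apply (c c' : HermitianCoord F m) :
    hermitianForm F m c c' =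
      re (hermitianOfCoord (F := F) c * hermitianOfCoord (F := F) c').trace := rfl

theorem re_trace_conjTranspose_mul_self {ι κ : Type*} [Fintype ι] [Fintype κ]
    (A : Matrix ι κ F) : re (Aᴴ * A).trace = ∑ j, ∑ i, ‖A i j‖ ^ 2 := by
  simp [Matrix.trace, Matrix.mul_apply, re_sum, re_star_mul_self]

theorem hermitianForm_self_pos (c : HermitianCoord F m) (hc : c ≠ 0) :
    0 < hermitianForm F m c c := by
  have hne : hermitianOfCoord (F := F) c ≠ 0 := fun h =>
    hc (hermitianOfCoord_injective (h.trans (map_zero (hermitianLinear F m)).symm))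
  obtain ⟨i, j, hij⟩ : ∃ i j, hermitianOfCoord (F := F) c i j ≠ 0 := by
    by_contra! h
    exact hne (Matrix.ext h)
  have hnonneg : ∀ j, 0 ≤ ∑ i, ‖hermitianOfCoord (F := F) c i j‖ ^ 2 := fun j =>
    Finset.sum_nonneg fun i _ => sq_nonneg _
  rw [hermitianForm_apply]
  nth_rw 1 [← conjTranspose_hermitianOfCoord]
  rw [re_trace_conjTranspose_mul_self]
  exact Finset.sum_pos' (fun j _ => hnonneg j) ⟨j, Finset.mem_univ j,
    Finset.sum_pos' (fun i _ => sq_nonneg _)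
      ⟨i, Finset.mem_univ i, pow_pos (norm_pos_iff.2 hij) 2⟩⟩

theorem isAdjointPair_congruence (B : Matrix (Fin m) (Fin m) F) :
    LinearMap.IsAdjointPair (hermitianForm F m) (hermitianForm F m)
      (congruence B) (congruence Bᴴ) := by
  intro c c'
  rw [hermitianForm_apply, hermitianForm_apply, hermitianOfCoord_congruence,
    hermitianOfCoord_congruence, Matrix.conjTranspose_conjTranspose, Matrix.mul_assoc,
    Matrix.mul_assoc, re_trace_mul_comm]
  simp only [Matrix.mul_assoc]

theorem det_congruence_conjTranspose (B : Matrix (Fin m) (Fin m) F) :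
    LinearMap.det (congruence Bᴴ) = LinearMap.det (congruence B) :=
  (det_eq_det_of_isAdjointPair (separatingLeft_of_pos hermitianForm_self_pos)
    (isAdjointPair_congruence B)).symm

theorem det_congruence_sq_of_unitary {W : Matrix (Fin m) (Fin m) F} (hW : W * Wᴴ = 1) :
    LinearMap.det (congruence W) ^ 2 = 1 := by
  nth_rw 1 [sq, ← det_congruence_conjTranspose, ← LinearMap.det_comp, ← congruence_mul,
    mul_eq_one_symm hW, congruence_one, LinearMap.det_id]

theorem realDiagonal_conj_apply (d : Fin m → ℝ) (A : Matrix (Fin m) (Fin m) F) (i j : Fin m) :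
    (realDiagonal F d * A * (realDiagonal F d)ᴴ) i j = (d i * d j) • A i j := by
  rw [conjTranspose_realDiagonal, realDiagonal, Matrix.mul_diagonal, Matrix.diagonal_mul,
    ← Algebra.commutes, ← Algebra.smul_def, ← Algebra.smul_def, smul_smul, mul_comm]

theorem det_congruence_realDiagonal (d : Fin m → ℝ) :
    LinearMap.det (congruence (realDiagonal F d)) = (∏ i, d i) ^ (2 + (m - 1) * dim F) := by
  have hprod : congruence (realDiagonal F d) = LinearMap.prodMap
      (LinearMap.pi fun i => (d i ^ 2 • LinearMap.id) ∘ₗ LinearMap.proj i)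
      (LinearMap.pi fun p => ((d p.1.1 * d p.1.2) • LinearMap.id) ∘ₗ LinearMap.proj p) := by
    refine LinearMap.ext fun c => Prod.ext (funext fun i => ?_) (funext fun p => ?_)
    · change re ((realDiagonal F d * hermitianOfCoord c * (realDiagonal F d)ᴴ) i i) = _
      simp [realDiagonal_conj_apply, re_smul, hermitianOfCoord, re_algebraMap, sq]
    · change (coordEquiv F).symm
        ((realDiagonal F d * hermitianOfCoord c * (realDiagonal F d)ᴴ) p.1.1 p.1.2) = _
      simp [realDiagonal_conj_apply, hermitianOfCoord, p.2, ← coordEquiv_apply]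
  rw [hprod, LinearMap.det_prodMap, LinearMap.det_pi, LinearMap.det_pi]
  simp only [LinearMap.det_smul, LinearMap.det_id, mul_one, Module.finrank_self, pow_one,
    Module.finrank_pi, Fintype.card_fin, Finset.prod_pow]
  rw [prod_ordered_pairs_mul, Fintype.card_fin, pow_add, pow_mul]

theorem abs_det_congruence (B : Matrix (Fin m) (Fin m) F) :
    |LinearMap.det (congruence B)| = det B ^ (2 + (m - 1) * dim F) := by
  obtain ⟨W, d, hW, hB⟩ := exists_unitary_diagonalization (A := Bᴴ * B) (by simp)
  have hdet : det B ^ 2 = |∏ i, d i| := by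
    rw [← det_realDiagonal (F := F), sq]
    nth_rw 1 [← det_conjTranspose B]
    rw [← det_mul, hB, det_mul, det_mul, det_conjTranspose, det_eq_one_of_unitary hW, one_mul,
      mul_one]
  have hcong : LinearMap.det (congruence B) ^ 2 = (∏ i, d i) ^ (2 + (m - 1) * dim F) := by
    rw [sq]
    nth_rw 1 [← det_congruence_conjTranspose B]
    rw [← LinearMap.det_comp, ← congruence_mul, hB, congruence_mul, congruence_mul,
      LinearMap.det_comp, LinearMap.det_comp, det_congruence_conjTranspose,
      det_congruence_realDiagonal, mul_right_comm, ← sq, det_congruence_sq_of_unitary hW, one_mul]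
  rw [← sq_eq_sq₀ (abs_nonneg _) (pow_nonneg (det_nonneg B) _), ← pow_mul, mul_comm, pow_mul,
    hdet, ← abs_pow, ← abs_pow, hcong]

end Congruence

section Measurability

instance instSecondCountableTopologyMatrix {ι κ : Type*} [Countable ι] [Countable κ] :
    SecondCountableTopology (Matrix ι κ F) :=
  inferInstanceAs (SecondCountableTopology (ι → κ → F))

theorem isOpen_forall_sphere_re_pos :
    IsOpen {A : Matrix (Fin m) (Fin m) F |
      ∀ x ∈ Metric.sphere (0 : Fin m → F) 1, 0 < re (star x ⬝ᵥ (A *ᵥ x))} := by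
  have hcont : Continuous fun z : Matrix (Fin m) (Fin m) F × (Fin m → F) =>
      re (star z.2 ⬝ᵥ (z.1 *ᵥ z.2)) :=
    continuous_re.comp (continuous_snd.star.dotProduct
      (continuous_fst.matrix_mulVec continuous_snd))
  refine isOpen_iff_mem_nhds.2 fun A hA => ?_
  exact (isCompact_sphere (0 : Fin m → F) 1).eventually_forall_of_forall_eventually
    fun x hx => hcont.continuousAt.eventually (lt_mem_nhds (hA x hx))

theorem posDef_iff_forall_sphere {A : Matrix (Fin m) (Fin m) F} :
    PosDef A ↔ Aᴴ = A ∧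
      ∀ x ∈ Metric.sphere (0 : Fin m → F) 1, 0 < re (star x ⬝ᵥ (A *ᵥ x)) := by
  refine and_congr_right fun _ => ⟨fun h x hx => h x ?_, fun h x hx => ?_⟩
  · exact ne_zero_of_mem_unit_sphere ⟨x, hx⟩
  · have hinv : 0 < ‖x‖⁻¹ := inv_pos.2 (norm_pos_iff.2 hx)
    have hunit := h (‖x‖⁻¹ • x) (by simp [norm_smul, hx])
    rw [star_smul, star_trivial ‖x‖⁻¹, Matrix.mulVec_smul, smul_dotProduct, dotProduct_smul,
      re_smul, re_smul] at hunit
    exact pos_of_mul_pos_right (pos_of_mul_pos_right hunit hinv.le) hinv.le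

variable [MeasurableSpace F] [BorelSpace F]

instance instBorelSpaceMatrix {ι κ : Type*} [Countable ι] [Countable κ] :
    BorelSpace (Matrix ι κ F) :=
  inferInstanceAs (BorelSpace (ι → κ → F))

theorem measurableSet_posDef : MeasurableSet {A : Matrix (Fin m) (Fin m) F | PosDef A} := by
  simp only [posDef_iff_forall_sphere, Set.ofPred_and]
  exact (isClosed_eq continuous_id.matrix_conjTranspose continuous_id).measurableSet.inter
    isOpen_forall_sphere_re_pos.measurableSet

open scoped Matrix.Norms.Operator in
theorem measurable_matrix_ringInverse :
    Measurable (Ring.inverse : Matrix (Fin m) (Fin m) F → Matrix (Fin m) (Fin m) F) :=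
  have : @BorelSpace _ PseudoMetricSpace.toUniformSpace.toTopologicalSpace _ :=
    instBorelSpaceMatrix (F := F) (ι := Fin m) (κ := Fin m)
  measurable_ringInverse

end Measurability

section LebesgueMeasure

variable (F m n) in
/-- The identification of `F ^ (m × n)` with its real coordinates that defines `lebesgue`. -/
def matrixCoordEquiv : (Fin m → Fin n → Fin (dim F) → ℝ) ≃ₗ[ℝ] Matrix (Fin m) (Fin n) F :=
  (LinearEquiv.piCongrRight fun _ => LinearEquiv.piCongrRight fun _ => coordEquiv F).trans
    (Matrix.ofLinearEquiv ℝ)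

theorem lebesgue_eq_map [MeasurableSpace F] :
    lebesgue F m n = volume.map (matrixCoordEquiv F m n) :=
  congrArg (Measure.map · volume) <|
    funext fun c => Matrix.ext fun i j => (coordEquiv_apply (c i j)).symm

variable (n) in
/-- The real-linear endomorphism `X ↦ A X` of `F ^ (m × n)`. -/
def mulLeftReal (A : Matrix (Fin m) (Fin m) F) :
    Matrix (Fin m) (Fin n) F →ₗ[ℝ] Matrix (Fin m) (Fin n) F where
  toFun X := A * X
  map_add' X Y := Matrix.mul_add A X Y
  map_smul' r X := Matrix.mul_smul A r X

theorem det_mulLeftReal (A : Matrix (Fin m) (Fin m) F) :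
    LinearMap.det (mulLeftReal n A) = LinearMap.det (mulVecReal A) ^ n := by
  let columns : Matrix (Fin m) (Fin n) F ≃ₗ[ℝ] (Fin n → Fin m → F) :=
    (Matrix.transposeLinearEquiv (Fin m) (Fin n) ℝ F).trans (Matrix.ofLinearEquiv ℝ).symm
  have hcolumns : columns.toLinearMap ∘ₗ mulLeftReal n A ∘ₗ columns.symm.toLinearMap =
      LinearMap.pi fun j => mulVecReal A ∘ₗ LinearMap.proj j := rfl
  rw [← LinearMap.det_conj (mulLeftReal n A) columns, hcolumns, LinearMap.det_pi]
  simp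

theorem abs_det_mulLeftReal (A : Matrix (Fin m) (Fin m) F) :
    |LinearMap.det (mulLeftReal n A)| = det A ^ (dim F * n) := by
  rw [det_mulLeftReal, abs_pow, abs_det_mulVecReal, pow_mul]

variable [MeasurableSpace F] [BorelSpace F]

instance instIsAddHaarMeasureLebesgue : (lebesgue F m n).IsAddHaarMeasure := by
  rw [lebesgue_eq_map]
  exact inferInstanceAs
    (Measure.map (matrixCoordEquiv F m n).toContinuousLinearEquiv volume).IsAddHaarMeasure

instance instSFiniteLebesgue : SFinite (lebesgue F m n) := by
  rw [lebesgue]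
  infer_instance

theorem lebesgue_map_mul_left {A : Matrix (Fin m) (Fin m) F} (hA : IsUnit A) :
    (lebesgue F m n).map (fun X => A * X) =
      ENNReal.ofReal (det A ^ (dim F * n))⁻¹ • lebesgue F m n := by
  let e := matrixCoordEquiv F m n
  let f := e.symm.toLinearMap ∘ₗ mulLeftReal n A ∘ₗ e.toLinearMap
  have hdet : |LinearMap.det f| = det A ^ (dim F * n) := by
    rw [← abs_det_mulLeftReal, ← LinearMap.det_conj (mulLeftReal n A) e.symm]
    rfl
  rw [← hdet, lebesgue_eq_map]
  refine map_map_of_semiconj volume (f := f) ?_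
    e.toLinearMap.continuous_of_finiteDimensional.measurable
    (continuous_const.matrix_mul continuous_id).measurable
    fun c => e.apply_symm_apply (A * e c)
  rw [← abs_pos, hdet]
  exact pow_pos (det_pos_of_isUnit hA) _

theorem measurable_hermitianOfCoord :
    Measurable (hermitianOfCoord : HermitianCoord F m → Matrix (Fin m) (Fin m) F) :=
  (hermitianLinear F m).continuous_of_finiteDimensional.measurable

theorem measurable_conj (B : Matrix (Fin m) (Fin m) F) :
    Measurable fun V : Matrix (Fin m) (Fin m) F => B * V * Bᴴ :=
  ((continuous_const.matrix_mul continuous_id).matrix_mul continuous_const).measurable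

theorem lebesgueHermitian_map_conj {B : Matrix (Fin m) (Fin m) F} (hB : IsUnit B) :
    (lebesgueHermitian F m).map (fun V => B * V * Bᴴ) =
      ENNReal.ofReal (det B ^ (2 + (m - 1) * dim F))⁻¹ • lebesgueHermitian F m := by
  have : (volume : Measure (HermitianCoord F m)).IsAddHaarMeasure :=
    Measure.prod.instIsAddHaarMeasure _ _
  have hdet : LinearMap.det (congruence B) ≠ 0 := by
    rw [← abs_pos, abs_det_congruence]
    exact pow_pos (det_pos_of_isUnit hB) _
  rw [← abs_det_congruence]
  exact map_map_of_semiconj volume hdet measurable_hermitianOfCoord (measurable_conj B)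
    (hermitianOfCoord_congruence B)

theorem lebesgueCone_map_conj {B : Matrix (Fin m) (Fin m) F} (hB : IsUnit B) :
    (lebesgueCone F m).map (fun V => B * V * Bᴴ) =
      ENNReal.ofReal (det B ^ (2 + (m - 1) * dim F))⁻¹ • lebesgueCone F m := by
  have hcone : {V : Matrix (Fin m) (Fin m) F | PosDef V} =
      (fun V => B * V * Bᴴ) ⁻¹' {V | PosDef V} :=
    Set.ext fun V => (posDef_conj_iff hB).symm
  rw [lebesgueCone]
  nth_rw 1 [hcone]
  rw [← Measure.restrict_map (measurable_conj B) measurableSet_posDef,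
    lebesgueHermitian_map_conj hB, Measure.restrict_smul]

end LebesgueMeasure

section Gamma

/-- The unnormalised matrix Gamma density `etr(-A V) |V| ^ (a - (m - 1) β / 2 - 1)` with shape `a`
and rate `A`; `multiGamma` integrates it at the rate `1`. -/
def gammaKernel (a : ℝ) (A V : Matrix (Fin m) (Fin m) F) : ℝ :=
  Real.exp (-re (Matrix.trace (A * V))) * det V ^ (a - ((m : ℝ) - 1) * beta F / 2 - 1)

theorem gammaKernel_nonneg (a : ℝ) (A V : Matrix (Fin m) (Fin m) F) : 0 ≤ gammaKernel a A V :=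
  mul_nonneg (Real.exp_pos _).le (Real.rpow_nonneg (det_nonneg V) _)

theorem gammaKernel_conj (a : ℝ) (A B V : Matrix (Fin m) (Fin m) F) :
    gammaKernel a A (B * V * Bᴴ) =
      (det B ^ 2) ^ (a - ((m : ℝ) - 1) * beta F / 2 - 1) * gammaKernel a (Bᴴ * A * B) V := by
  have hdet : det (B * V * Bᴴ) = det B ^ 2 * det V := by
    rw [det_mul, det_mul, det_conjTranspose]
    ring
  have htrace : re (Matrix.trace (A * (B * V * Bᴴ))) = re (Matrix.trace (Bᴴ * A * B * V)) := by
    rw [← Matrix.mul_assoc, re_trace_mul_comm]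
    simp only [Matrix.mul_assoc]
  rw [gammaKernel, gammaKernel, hdet, htrace, Real.mul_rpow (sq_nonneg _) (det_nonneg V)]
  ring

theorem det_pow_eq_sq_rpow (B : Matrix (Fin m) (Fin m) F) :
    det B ^ (2 + (m - 1) * dim F) = (det B ^ 2) ^ (((m : ℝ) - 1) * beta F / 2 + 1) := by
  rcases m with _ | m
  -- For `m = 0` the exponents differ because `m - 1` truncates, but `|B| = 1`.
  · simp [Subsingleton.elim B 1, det_one]
  · rw [← Real.rpow_natCast, ← Real.rpow_two, ← Real.rpow_mul (det_nonneg B)]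
    congr 1
    push_cast
    ring

variable [MeasurableSpace F]

theorem multiGamma_nonneg (a : ℝ) : 0 ≤ multiGamma F m a :=
  integral_nonneg fun V => mul_nonneg (Real.exp_pos _).le (Real.rpow_nonneg (det_nonneg V) _)

variable (F m) in
/-- The multivariate Gamma function with values in `[0, ∞]`, where a divergent integral is `∞`
rather than `0`. -/
def lmultiGamma (a : ℝ) : ENNReal :=
  ∫⁻ V, ENNReal.ofReal (gammaKernel a 1 V) ∂lebesgueCone F m

variable [BorelSpace F]

theorem measurable_gammaKernel (a : ℝ) (A : Matrix (Fin m) (Fin m) F) :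
    Measurable (gammaKernel a A) :=
  ((continuous_re.comp
    (continuous_const.matrix_mul continuous_id).matrix_trace).measurable.neg.exp).mul
    (continuous_det.measurable.pow_const _)

theorem multiGamma_eq_toReal (a : ℝ) : multiGamma F m a = (lmultiGamma F m a).toReal := by
  simp only [multiGamma, lmultiGamma]
  rw [← integral_eq_lintegral_of_nonneg_ae (.of_forall fun V => gammaKernel_nonneg a 1 V)
    (measurable_gammaKernel a 1).aestronglyMeasurable]
  simp only [gammaKernel, Matrix.one_mul]

theorem lintegral_gammaKernel (a : ℝ) {A : Matrix (Fin m) (Fin m) F} (hA : PosDef A) :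
    ∫⁻ V, ENNReal.ofReal (gammaKernel a A V) ∂lebesgueCone F m =
      ENNReal.ofReal (det A ^ (-a)) * lmultiGamma F m a := by
  obtain ⟨B, rfl⟩ := hA.exists_conjTranspose_mul_self
  have hB : IsUnit B := isUnit_of_mul_isUnit_right hA.isUnit
  set p := a - ((m : ℝ) - 1) * beta F / 2 - 1 with hp
  set q := ((m : ℝ) - 1) * beta F / 2 + 1 with hq
  have hdet : det (Bᴴ * B) = det B ^ 2 := by rw [det_mul, det_conjTranspose, sq]
  have hpos : 0 < det B ^ 2 := hdet ▸ hA.det_pos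
  have hchange :
      ENNReal.ofReal ((det B ^ 2) ^ p) *
          ∫⁻ V, ENNReal.ofReal (gammaKernel a (Bᴴ * B) V) ∂lebesgueCone F m =
        ENNReal.ofReal ((det B ^ 2) ^ (-q)) * lmultiGamma F m a := by
    have h := lintegral_map (μ := lebesgueCone F m)
      (measurable_gammaKernel (F := F) a 1).ennreal_ofReal (measurable_conj B)
    simp only [lebesgueCone_map_conj hB, lintegral_smul_measure, smul_eq_mul, gammaKernel_conj,
      Matrix.mul_one, det_pow_eq_sq_rpow, ENNReal.ofReal_mul (Real.rpow_nonneg hpos.le _)] at h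
    rw [lintegral_const_mul' _ _ ENNReal.ofReal_ne_top] at h
    rw [Real.rpow_neg hpos.le]
    exact h.symm
  calc ∫⁻ V, ENNReal.ofReal (gammaKernel a (Bᴴ * B) V) ∂lebesgueCone F m
      = ENNReal.ofReal ((det B ^ 2) ^ (-p)) * (ENNReal.ofReal ((det B ^ 2) ^ p) *
          ∫⁻ V, ENNReal.ofReal (gammaKernel a (Bᴴ * B) V) ∂lebesgueCone F m) := by
        rw [← mul_assoc, ← ENNReal.ofReal_mul (Real.rpow_nonneg hpos.le _),
          ← Real.rpow_add hpos, neg_add_cancel, Real.rpow_zero, ENNReal.ofReal_one, one_mul]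
    _ = ENNReal.ofReal ((det B ^ 2) ^ (-a)) * lmultiGamma F m a := by
        rw [hchange, ← mul_assoc, ← ENNReal.ofReal_mul (Real.rpow_nonneg hpos.le _),
          ← Real.rpow_add hpos, show -p + -q = -a by rw [hp, hq]; ring]
    _ = ENNReal.ofReal (det (Bᴴ * B) ^ (-a)) * lmultiGamma F m a := by rw [hdet]

end Gamma

section MatrixNormal

theorem normalDensity_mul_add (M μ Y : Matrix (Fin m) (Fin n) F) (Θ : Matrix (Fin m) (Fin m) F)
    (S : Matrix (Fin n) (Fin n) F) {A : Matrix (Fin m) (Fin m) F} (hA : IsUnit A) :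
    normalDensity M Θ S Y = det A ^ (dim F * n) *
      normalDensity (A * M + μ) (A * Θ * Aᴴ) S (A * Y + μ) := by
  have hApos := det_pos_of_isUnit hA
  have hdet : det (A * Θ * Aᴴ) ^ (beta F * n / 2) =
      det A ^ (dim F * n) * det Θ ^ (beta F * n / 2) := by
    rw [det_mul, det_mul, det_conjTranspose, mul_right_comm, ← sq,
      Real.mul_rpow (sq_nonneg _) (det_nonneg Θ), ← Real.rpow_two, ← Real.rpow_mul hApos.le,
      ← Real.rpow_natCast]
    congr 2
    push_cast
    ring
  have htrace : re (Matrix.trace (Ring.inverse (A * Θ * Aᴴ) * (A * Y + μ - (A * M + μ)) *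
        Ring.inverse S * (A * Y + μ - (A * M + μ))ᴴ)) =
      re (Matrix.trace (Ring.inverse Θ * (Y - M) * Ring.inverse S * (Y - M)ᴴ)) := by
    have hA' : IsUnit Aᴴ := hA.star
    rw [Ring.inverse_mul (.inr hA'), Ring.inverse_mul (.inl hA), add_sub_add_right_eq_sub,
      ← Matrix.mul_sub, Matrix.conjTranspose_mul, ← Matrix.mul_assoc, re_trace_mul_comm]
    simp only [← Matrix.mul_assoc]
    rw [Ring.mul_inverse_cancel _ hA', Matrix.one_mul, Matrix.mul_assoc _ (Ring.inverse A) A,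
      Ring.inverse_mul_cancel A hA, Matrix.mul_one]
  rw [normalDensity, normalDensity, hdet, htrace]
  field_simp

variable [MeasurableSpace F]

/-- The matrix normal distribution `N_{m×n}^β(M, Θ ⊗ S)`. -/
def matrixNormal (M : Matrix (Fin m) (Fin n) F) (Θ : Matrix (Fin m) (Fin m) F)
    (S : Matrix (Fin n) (Fin n) F) : Measure (Matrix (Fin m) (Fin n) F) :=
  (lebesgue F m n).withDensity fun Y => ENNReal.ofReal (normalDensity M Θ S Y)

variable [BorelSpace F]

theorem measurable_normalDensity (M : Matrix (Fin m) (Fin n) F) (S : Matrix (Fin n) (Fin n) F) :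
    Measurable fun z : Matrix (Fin m) (Fin m) F × Matrix (Fin m) (Fin n) F =>
      normalDensity M z.1 S z.2 := by
  have htrace : Continuous fun z : Matrix (Fin m) (Fin m) F × Matrix (Fin m) (Fin n) F =>
      re (Matrix.trace (z.1 * (z.2 - M) * Ring.inverse S * (z.2 - M)ᴴ)) := by
    have hsub : Continuous fun z : Matrix (Fin m) (Fin m) F × Matrix (Fin m) (Fin n) F =>
        z.2 - M := continuous_snd.sub continuous_const
    exact continuous_re.comp (((continuous_fst.matrix_mul hsub).matrix_mul
      continuous_const).matrix_mul hsub.matrix_conjTranspose).matrix_trace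
  have hinv : Measurable fun z : Matrix (Fin m) (Fin m) F × Matrix (Fin m) (Fin n) F =>
      (Ring.inverse z.1, z.2) :=
    (measurable_matrix_ringInverse.comp measurable_fst).prodMk measurable_snd
  exact (((((continuous_det.measurable.comp measurable_fst).pow_const _).const_mul _).mul_const
    _).const_div 1).mul ((htrace.measurable.comp hinv).const_mul _).exp

theorem matrixNormal_map_mul_add (M μ : Matrix (Fin m) (Fin n) F)
    (Θ : Matrix (Fin m) (Fin m) F) (S : Matrix (Fin n) (Fin n) F)
    {A : Matrix (Fin m) (Fin m) F} (hA : IsUnit A) :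
    (matrixNormal M Θ S).map (fun Y => A * Y + μ) =
      matrixNormal (A * M + μ) (A * Θ * Aᴴ) S := by
  have hJ : 0 < det A ^ (dim F * n) := pow_pos (det_pos_of_isUnit hA) _
  have hmul : Measurable fun Y : Matrix (Fin m) (Fin n) F => A * Y :=
    (continuous_const.matrix_mul continuous_id).measurable
  have hadd : Measurable fun Y : Matrix (Fin m) (Fin n) F => Y + μ := measurable_id.add_const μ
  refine map_withDensity_of_map_eq_smul (hadd.comp hmul)
    ((measurable_normalDensity _ S).comp measurable_prodMk_left).ennreal_ofReal
    (c := ENNReal.ofReal (det A ^ (dim F * n))) ENNReal.ofReal_ne_top ?_ fun Y => ?_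
  · rw [← Function.comp_def (fun Y => Y + μ), ← Measure.map_map hadd hmul,
      lebesgue_map_mul_left hA, Measure.map_smul, map_add_right_eq_self, smul_smul,
      ← ENNReal.ofReal_mul hJ.le, mul_inv_cancel₀ hJ.ne',
      ENNReal.ofReal_one, one_smul]
  · rw [← ENNReal.ofReal_mul hJ.le, normalDensity_mul_add M μ Y Θ S hA]

theorem measurable_inverse_mul_add (μ : Matrix (Fin m) (Fin n) F) :
    Measurable fun z : Matrix (Fin m) (Fin m) F × Matrix (Fin m) (Fin n) F =>
      Ring.inverse z.1 * z.2 + μ := by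
  have hmul : Continuous fun z : Matrix (Fin m) (Fin m) F × Matrix (Fin m) (Fin n) F =>
      z.1 * z.2 + μ := (continuous_fst.matrix_mul continuous_snd).add continuous_const
  exact hmul.measurable.comp (measurable_matrix_ringInverse.prodMap measurable_id)

theorem matrixNormal_map_inverse_mul_add (μ : Matrix (Fin m) (Fin n) F)
    (S : Matrix (Fin n) (Fin n) F) {L : Matrix (Fin m) (Fin m) F} (hL : IsUnit L) :
    (matrixNormal 0 1 S).map (fun Y : Matrix (Fin m) (Fin n) F => Ring.inverse L * Y + μ) =
      matrixNormal μ (Ring.inverse (Lᴴ * L)) S := by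
  rw [matrixNormal_map_mul_add 0 μ 1 S hL.ringInverse, Matrix.mul_zero, zero_add, Matrix.mul_one,
    Ring.inverse_mul (.inr hL), ← Matrix.star_eq_conjTranspose, ← Matrix.star_eq_conjTranspose,
    Ring.inverse_star]

end MatrixNormal

section Wishart

variable [MeasurableSpace F]

/-- The Wishart distribution `W_m^β(ν, Ξ)`. -/
def wishart (ν : ℝ) (Ξ : Matrix (Fin m) (Fin m) F) : Measure (Matrix (Fin m) (Fin m) F) :=
  (lebesgueCone F m).withDensity fun V => ENNReal.ofReal (wishartDensity ν Ξ V)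

theorem wishartDensity_nonneg (ν : ℝ) (Ξ V : Matrix (Fin m) (Fin m) F) :
    0 ≤ wishartDensity ν Ξ V := by
  have hβ := beta_pos (F := F)
  have hdetΞ := det_nonneg Ξ
  have hdetV := det_nonneg V
  have hΓ := multiGamma_nonneg (F := F) (m := m) (beta F * ν / 2)
  rw [wishartDensity]
  positivity

variable {Ω : Type*} [MeasurableSpace Ω] {P : Measure Ω} {V : Ω → Matrix (Fin m) (Fin m) F}
  {ν : ℝ} {Ξ : Matrix (Fin m) (Fin m) F}

theorem IsWishart.multiGamma_ne_zero [NeZero P] (hV : IsWishart V P ν Ξ) :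
    multiGamma F m (beta F * ν / 2) ≠ 0 := by
  intro hzero
  have hdensity : wishartDensity ν Ξ = fun _ => 0 := by
    funext W
    simp [wishartDensity, hzero]
  have hlaw := hV.2
  simp only [hdensity, ENNReal.ofReal_zero, withDensity_const, zero_smul,
    Measure.map_eq_zero_iff hV.1] at hlaw
  exact NeZero.ne P hlaw

variable [BorelSpace F]

theorem measurable_wishartDensity (ν : ℝ) (Ξ : Matrix (Fin m) (Fin m) F) :
    Measurable (wishartDensity ν Ξ) :=
  ((continuous_det.measurable.pow_const _).const_mul _).mul ((continuous_re.comp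
    (continuous_const.matrix_mul continuous_id).matrix_trace).measurable.const_mul _).exp

theorem IsWishart.ae_posDef (hV : IsWishart V P ν Ξ) : ∀ᵐ ω ∂P, PosDef (V ω) := by
  refine ae_of_ae_map hV.1 ?_
  rw [hV.2]
  exact (withDensity_absolutelyContinuous _ _).ae_le (ae_restrict_mem measurableSet_posDef)

end Wishart

section MatricvariateT

variable {Ξ : Matrix (Fin m) (Fin m) F} {S : Matrix (Fin n) (Fin n) F}

/-- The matrix `Ξ⁻¹ + (T - μ) S⁻¹ (T - μ)*` of the matricvariate `T` density; given `T`, the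
Wishart matrix has a Gamma law with rate `β / 2` times this matrix. -/
def scatter (Ξ : Matrix (Fin m) (Fin m) F) (S : Matrix (Fin n) (Fin n) F)
    (μ T : Matrix (Fin m) (Fin n) F) : Matrix (Fin m) (Fin m) F :=
  Ring.inverse Ξ + (T - μ) * Ring.inverse S * (T - μ)ᴴ

theorem posDef_scatter (hΞ : PosDef Ξ) (hS : PosDef S) (μ T : Matrix (Fin m) (Fin n) F) :
    PosDef (scatter Ξ S μ T) :=
  hΞ.inverse.add_conj hS.inverse (T - μ)

theorem re_trace_scatter_mul (Ξ V : Matrix (Fin m) (Fin m) F) (S : Matrix (Fin n) (Fin n) F)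
    (μ T : Matrix (Fin m) (Fin n) F) :
    re (Matrix.trace (scatter Ξ S μ T * V)) = re (Matrix.trace (Ring.inverse Ξ * V)) +
      re (Matrix.trace (V * (T - μ) * Ring.inverse S * (T - μ)ᴴ)) := by
  rw [scatter, Matrix.add_mul, Matrix.trace_add, re_add,
    re_trace_mul_comm ((T - μ) * Ring.inverse S * (T - μ)ᴴ) V]
  simp only [Matrix.mul_assoc]

variable [MeasurableSpace F]

/-- The matricvariate `T` density without the factor `Γ_m^β[β(n + ν)/2]`. -/
def matricTKernel (ν : ℝ) (Ξ : Matrix (Fin m) (Fin m) F) (S : Matrix (Fin n) (Fin n) F)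
    (μ T : Matrix (Fin m) (Fin n) F) : ℝ :=
  1 / (Real.pi ^ ((m : ℝ) * n * beta F / 2) * multiGamma F m (beta F * ν / 2) *
      det Ξ ^ (beta F * ν / 2) * det S ^ (beta F * m / 2)) *
    det (scatter Ξ S μ T) ^ (-(beta F * (n + ν) / 2))

/-- The density of the matricvariate `T` distribution. -/
def matricTDensity (ν : ℝ) (Ξ : Matrix (Fin m) (Fin m) F) (S : Matrix (Fin n) (Fin n) F)
    (μ T : Matrix (Fin m) (Fin n) F) : ℝ :=
  multiGamma F m (beta F * (n + ν) / 2) /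
      (Real.pi ^ ((m : ℝ) * n * beta F / 2) * multiGamma F m (beta F * ν / 2) *
        det Ξ ^ (beta F * ν / 2) * det S ^ (beta F * m / 2)) *
    det (scatter Ξ S μ T) ^ (-(beta F * (n + ν) / 2))

theorem matricTDensity_eq_kernel_mul (ν : ℝ) (Ξ : Matrix (Fin m) (Fin m) F)
    (S : Matrix (Fin n) (Fin n) F) (μ T : Matrix (Fin m) (Fin n) F) :
    matricTDensity ν Ξ S μ T =
      matricTKernel ν Ξ S μ T * multiGamma F m (beta F * (n + ν) / 2) := by
  rw [matricTDensity, matricTKernel]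
  ring

theorem matricTKernel_pos {ν : ℝ} (hν : multiGamma F m (beta F * ν / 2) ≠ 0) (hΞ : PosDef Ξ)
    (hS : PosDef S) (μ T : Matrix (Fin m) (Fin n) F) : 0 < matricTKernel ν Ξ S μ T := by
  have hΓ : 0 < multiGamma F m (beta F * ν / 2) := (multiGamma_nonneg _).lt_of_ne' hν
  have hdetΞ := hΞ.det_pos
  have hdetS := hS.det_pos
  have hdet := (posDef_scatter hΞ hS μ T).det_pos
  rw [matricTKernel]
  positivity

/-- The constant relating the product of the Wishart density and the matrix normal density with
row covariance `V⁻¹` to `gammaKernel`. -/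
def mixtureConstant (ν : ℝ) (Ξ : Matrix (Fin m) (Fin m) F) (S : Matrix (Fin n) (Fin n) F) : ℝ :=
  1 / ((2 / beta F) ^ (beta F * m * ν / 2) * multiGamma F m (beta F * ν / 2) *
      det Ξ ^ (beta F * ν / 2)) *
    (1 / ((2 * Real.pi / beta F) ^ (beta F * m * n / 2) * det S ^ (beta F * m / 2)))

theorem mixtureConstant_nonneg (ν : ℝ) (Ξ : Matrix (Fin m) (Fin m) F)
    (S : Matrix (Fin n) (Fin n) F) : 0 ≤ mixtureConstant ν Ξ S := by
  have hβ := beta_pos (F := F)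
  have hΓ := multiGamma_nonneg (F := F) (m := m) (beta F * ν / 2)
  have hdetΞ := det_nonneg Ξ
  have hdetS := det_nonneg S
  rw [mixtureConstant]
  positivity

theorem mixtureConstant_mul_det_rpow (ν : ℝ) (Ξ : Matrix (Fin m) (Fin m) F)
    (S : Matrix (Fin n) (Fin n) F) (μ T : Matrix (Fin m) (Fin n) F) :
    mixtureConstant ν Ξ S * det ((beta F / 2) • scatter Ξ S μ T) ^ (-(beta F * (n + ν) / 2)) =
      matricTKernel ν Ξ S μ T := by
  have hβ : 0 < 2 / beta F := div_pos two_pos beta_pos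
  have hdet : det ((beta F / 2) • scatter Ξ S μ T) ^ (-(beta F * (n + ν) / 2)) =
      (2 / beta F) ^ (beta F * m * ν / 2) * (2 / beta F) ^ (beta F * m * n / 2) *
        det (scatter Ξ S μ T) ^ (-(beta F * (n + ν) / 2)) := by
    rw [det_smul, ← inv_div, abs_of_pos (inv_pos.2 hβ),
      Real.mul_rpow (pow_nonneg (inv_nonneg.2 hβ.le) _) (det_nonneg _), ← Real.rpow_natCast,
      ← Real.rpow_mul (inv_nonneg.2 hβ.le), Real.inv_rpow hβ.le, ← Real.rpow_neg hβ.le,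
      ← Real.rpow_add hβ]
    congr 2
    ring
  have hπ : (2 * Real.pi / beta F) ^ (beta F * m * n / 2) =
      (2 / beta F) ^ (beta F * m * n / 2) * Real.pi ^ ((m : ℝ) * n * beta F / 2) := by
    rw [mul_div_right_comm, Real.mul_rpow hβ.le Real.pi_pos.le]
    congr 2
    ring
  have hν : (2 / beta F) ^ (beta F * m * ν / 2) ≠ 0 := (Real.rpow_pos_of_pos hβ _).ne'
  have hn : (2 / beta F) ^ (beta F * m * n / 2) ≠ 0 := (Real.rpow_pos_of_pos hβ _).ne'
  rw [mixtureConstant, matricTKernel, hdet, hπ]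
  simp only [one_div, mul_inv]
  field_simp

theorem wishartDensity_mul_normalDensity (ν : ℝ) (Ξ : Matrix (Fin m) (Fin m) F)
    (S : Matrix (Fin n) (Fin n) F) (μ T : Matrix (Fin m) (Fin n) F)
    {V : Matrix (Fin m) (Fin m) F} (hV : IsUnit V) :
    wishartDensity ν Ξ V * normalDensity μ (Ring.inverse V) S T =
      mixtureConstant ν Ξ S *
        gammaKernel (beta F * (n + ν) / 2) ((beta F / 2) • scatter Ξ S μ T) V := by
  have hdet : (det V ^ (beta F * n / 2)) * det V ^ (beta F * (ν - m + 1) / 2 - 1) =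
      det V ^ (beta F * (n + ν) / 2 - ((m : ℝ) - 1) * beta F / 2 - 1) := by
    rw [← Real.rpow_add (det_pos_of_isUnit hV)]
    congr 1
    ring
  have hexp : Real.exp (-re (Matrix.trace ((beta F / 2) • scatter Ξ S μ T * V))) =
      Real.exp (-(beta F / 2) * re (Matrix.trace (Ring.inverse Ξ * V))) *
        Real.exp (-(beta F / 2) *
          re (Matrix.trace (V * (T - μ) * Ring.inverse S * (T - μ)ᴴ))) := by
    rw [Matrix.smul_mul, Matrix.trace_smul, re_smul, re_trace_scatter_mul, ← neg_mul, mul_add,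
      Real.exp_add]
  rw [wishartDensity, normalDensity, mixtureConstant, gammaKernel, hexp, ← hdet,
    Ring.inverse_inverse hV, det_inverse hV, Real.inv_rpow (det_nonneg V)]
  simp only [one_div, mul_inv, inv_inv]
  ring

variable [BorelSpace F]

theorem lintegral_normalDensity_wishart (ν : ℝ) (hΞ : PosDef Ξ) (hS : PosDef S)
    (μ T : Matrix (Fin m) (Fin n) F) :
    ∫⁻ V, ENNReal.ofReal (normalDensity μ (Ring.inverse V) S T) ∂wishart ν Ξ =
      ENNReal.ofReal (matricTKernel ν Ξ S μ T) * lmultiGamma F m (beta F * (n + ν) / 2) := by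
  have hW := (measurable_wishartDensity ν Ξ).ennreal_ofReal
  have hN : Measurable fun V : Matrix (Fin m) (Fin m) F =>
      ENNReal.ofReal (normalDensity μ (Ring.inverse V) S T) :=
    ((measurable_normalDensity μ S).comp
      (measurable_matrix_ringInverse.prodMk measurable_const)).ennreal_ofReal
  have hC := mixtureConstant_nonneg ν Ξ S
  calc ∫⁻ V, ENNReal.ofReal (normalDensity μ (Ring.inverse V) S T) ∂wishart ν Ξ
      = ∫⁻ V, ENNReal.ofReal (mixtureConstant ν Ξ S) * ENNReal.ofReal
          (gammaKernel (beta F * (n + ν) / 2) ((beta F / 2) • scatter Ξ S μ T) V)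
          ∂lebesgueCone F m := by
        rw [wishart, lintegral_withDensity_eq_lintegral_mul _ hW hN]
        refine lintegral_congr_ae ?_
        filter_upwards [ae_restrict_mem measurableSet_posDef] with V hV
        rw [Pi.mul_apply, ← ENNReal.ofReal_mul (wishartDensity_nonneg ν Ξ V),
          wishartDensity_mul_normalDensity ν Ξ S μ T (PosDef.isUnit hV), ENNReal.ofReal_mul hC]
    _ = ENNReal.ofReal (mixtureConstant ν Ξ S *
          det ((beta F / 2) • scatter Ξ S μ T) ^ (-(beta F * (n + ν) / 2))) *
          lmultiGamma F m (beta F * (n + ν) / 2) := by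
        rw [lintegral_const_mul' _ _ ENNReal.ofReal_ne_top, lintegral_gammaKernel _
          ((posDef_scatter hΞ hS μ T).smul (half_pos beta_pos)), ← mul_assoc,
          ← ENNReal.ofReal_mul hC]
    _ = _ := by rw [mixtureConstant_mul_det_rpow]

variable {Ω : Type*} [MeasurableSpace Ω] {P : Measure Ω}

theorem map_inverse_mul_add_eq_mixture [IsFiniteMeasure P]
    {V L : Ω → Matrix (Fin m) (Fin m) F} {Y : Ω → Matrix (Fin m) (Fin n) F}
    (hY : IsMatrixNormal Y P 0 1 S) (hV : AEMeasurable V P) (hL : AEMeasurable L P)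
    (hunit : ∀ᵐ ω ∂P, IsUnit (L ω)) (hLV : ∀ᵐ ω ∂P, (L ω)ᴴ * L ω = V ω)
    (hLY : IndepFun L Y P) (μ : Matrix (Fin m) (Fin n) F) :
    P.map (fun ω => Ring.inverse (L ω) * Y ω + μ) = (lebesgue F m n).withDensity fun T =>
      ∫⁻ V, ENNReal.ofReal (normalDensity μ (Ring.inverse V) S T) ∂P.map V := by
  refine map_eq_withDensity_of_conditional_density hL hY.1 hV hLY
    (φ := fun z => Ring.inverse z.1 * z.2 + μ) (measurable_inverse_mul_add μ)
    ((measurable_normalDensity μ S).comp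
      (measurable_matrix_ringInverse.prodMap measurable_id)).ennreal_ofReal ?_
  filter_upwards [hunit, hLV] with ω hLω hLVω
  rw [hY.2, ← hLVω]
  exact matrixNormal_map_inverse_mul_add μ S hLω

end MatricvariateT

end MatricT

end

theorem mainTheorem1_general {F : Type*} [NormedDivisionRing F] [NormedAlgebra ℝ F] [StarRing F]
    [MatricT.RealNormedDivisionAlgebra F] [MeasurableSpace F] [BorelSpace F]
    {Ω : Type*} [MeasurableSpace Ω] {P : Measure Ω} [IsProbabilityMeasure P]
    {m n : ℕ} {ν : ℝ} {Ξ : Matrix (Fin m) (Fin m) F} (hΞ : MatricT.PosDef Ξ)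
    {S : Matrix (Fin n) (Fin n) F} (hS : MatricT.PosDef S) (μ : Matrix (Fin m) (Fin n) F)
    {V L : Ω → Matrix (Fin m) (Fin m) F} {Y : Ω → Matrix (Fin m) (Fin n) F}
    (hV : MatricT.IsWishart V P ν Ξ) (hY : MatricT.IsMatrixNormal Y P 0 1 S)
    (hL : AEMeasurable L P) (hLV : ∀ᵐ ω ∂P, (L ω)ᴴ * L ω = V ω) (hLY : IndepFun L Y P) :
    MatricT.HasDensity (fun ω => Ring.inverse (L ω) * Y ω + μ) P (MatricT.lebesgue F m n)
      (MatricT.matricTDensity ν Ξ S μ) := by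
  have hT : AEMeasurable (fun ω => Ring.inverse (L ω) * Y ω + μ) P :=
    (MatricT.measurable_inverse_mul_add μ).comp_aemeasurable (f := fun ω => (L ω, Y ω))
      (hL.prodMk hY.1)
  have hunit : ∀ᵐ ω ∂P, IsUnit (L ω) := by
    filter_upwards [hV.ae_posDef, hLV] with ω hVω hLVω
    exact isUnit_of_mul_isUnit_right (hLVω ▸ hVω.isUnit)
  have hlaw : P.map (fun ω => Ring.inverse (L ω) * Y ω + μ) =
      (MatricT.lebesgue F m n).withDensity fun T =>
        ENNReal.ofReal (MatricT.matricTKernel ν Ξ S μ T) *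
          MatricT.lmultiGamma F m (MatricT.beta F * (n + ν) / 2) := by
    rw [MatricT.map_inverse_mul_add_eq_mixture hY hV.1 hL hunit hLV hLY μ,
      show P.map V = MatricT.wishart ν Ξ from hV.2]
    simp only [MatricT.lintegral_normalDensity_wishart ν hΞ hS]
  have hpos := MatricT.matricTKernel_pos hV.multiGamma_ne_zero hΞ hS μ
  -- The law has total mass one and its kernel is positive, so the Gamma integral converges.
  have hfin : MatricT.lmultiGamma F m (MatricT.beta F * (n + ν) / 2) ≠ ⊤ := by
    have hprob := Measure.isProbabilityMeasure_map hT
    rw [hlaw] at hprob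
    exact MatricT.ne_top_of_isFiniteMeasure_withDensity_mul (κ := MatricT.lebesgue F m n)
      (fun T => (ENNReal.ofReal_pos.2 (hpos T)).ne') _
  refine ⟨hT, hlaw.trans ?_⟩
  simp only [MatricT.matricTDensity_eq_kernel_mul, MatricT.multiGamma_eq_toReal (_ * (_ + _) / _),
    ENNReal.ofReal_mul (hpos _).le, ENNReal.ofReal_toReal hfin]

theorem mainTheorem1 {F : Type*} [NormedDivisionRing F] [NormedAlgebra ℝ F] [StarRing F]
    [MatricT.RealNormedDivisionAlgebra F] [MeasurableSpace F] [BorelSpace F]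
    {Ω : Type*} [MeasurableSpace Ω] (P : Measure Ω) [IsProbabilityMeasure P]
    {m n : ℕ} (ν : ℝ) (hν : MatricT.beta F * ((m : ℝ) - 1) < ν)
    (Ξ : Matrix (Fin m) (Fin m) F) (hΞ : MatricT.PosDef Ξ)
    (S : Matrix (Fin n) (Fin n) F) (hS : MatricT.PosDef S)
    (μ : Matrix (Fin m) (Fin n) F)
    (V L : Ω → Matrix (Fin m) (Fin m) F) (Y : Ω → Matrix (Fin m) (Fin n) F)
    (hV : MatricT.IsWishart V P ν Ξ)
    (hY : MatricT.IsMatrixNormal Y P 0 1 S)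
    (hL : AEMeasurable L P) (hLV : ∀ᵐ ω ∂P, (L ω)ᴴ * L ω = V ω)
    (hLY : IndepFun L Y P) :
    MatricT.HasDensity (fun ω => Ring.inverse (L ω) * Y ω + μ) P (MatricT.lebesgue F m n)
      (fun T =>
        MatricT.multiGamma F m (MatricT.beta F * (n + ν) / 2) /
          (Real.pi ^ ((m : ℝ) * n * MatricT.beta F / 2) *
            MatricT.multiGamma F m (MatricT.beta F * ν / 2) *
            MatricT.det Ξ ^ (MatricT.beta F * ν / 2) *
            MatricT.det S ^ (MatricT.beta F * m / 2)) *
          MatricT.det (Ring.inverse Ξ + (T - μ) * Ring.inverse S * (T - μ)ᴴ) ^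
            (-(MatricT.beta F * (n + ν) / 2))) :=
  mainTheorem1_general hΞ hS μ hV hY hL hLV hLY
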